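/- Let $\Omega\subset\mathbb{C}$ be a bounded, finitely connected domain (its complement in the Riemann sphere has finitely many connected components), and assume that no component of $\mathbb{C}\setminus\Omega$ is a single point. Let $A^2(\Omega)$ be the Bergman space of holomorphic functions on $\Omega$ that are square integrable with respect to area. (1) A function $f$ on $\Omega$ is the orthogonal projection in $L^2(\Omega)$ of $\bar z$ onto $A^2(\Omega)$ if and only if $|z|^2=F(z)+\overline{F(z)}$ on $\partial\Omega$ for some (possibly multivalued) analytic function $F$ in $\Omega$ with $F'=f$ and with single-valued real part. That is: there is a continuous function $u:\overline\Omega\to\mathbb{R}$ with $u(\zeta)=|\zeta|^2$ for all $\zeta\in\partial\Omega$ such that near every point of $\Omega$ there is a holomorphic function $F$ with $F'=f$ and $F+\overline F=u$. (2) The Dirichlet problem in $\Omega$ with boundary data $|z|^2$ has exactly one solution $u$ (continuous on $\overline\Omega$, harmonic in $\Omega$, equal to $|z|^2$ on $\partial\Omega$), and a function $f$ on $\Omega$ is the best approximation to $\bar z$ from $A^2(\Omega)$ in the $L^2(\Omega)$ norm if and only if $f=F'$, where $F$ is a (possibly multivalued) analytic function in $\Omega$ with $u=F+\overline F$ (that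 is, near every point of $\Omega$ there is a holomorphic $F$ with $F'=f$ and $F+\overline F=u$). -/

import Mathlib

open MeasureTheory ComplexConjugate

/-- A set in the plane is finitely connected when its complement in the Riemann sphere
(the one-point compactification of the plane) has finitely many connected components. -/
def FinitelyConnected (Ω : Set ℂ) : Prop :=
  Finite (ConnectedComponents ↥((((↑) : ℂ → OnePoint ℂ) '' Ω)ᶜ : Set (OnePoint ℂ)))

/-- The Bergman space `A²(Ω)` : functions holomorphic in the open set `Ω` and square integrable
on `Ω` with respect to area. Only the values on `Ω` matter. -/
def bergmanSpace (Ω : Set ℂ) : Submodule ℂ (ℂ → ℂ) where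
  carrier := {f | DifferentiableOn ℂ f Ω ∧ MemLp f 2 (volume.restrict Ω)}
  add_mem' := fun hf hg => ⟨hf.1.add hg.1, hf.2.add hg.2⟩
  zero_mem' := ⟨differentiableOn_const (0 : ℂ), MemLp.zero'⟩
  smul_mem' := fun c _ hf => ⟨hf.1.const_smul c, hf.2.const_smul c⟩

/-- `f` is the orthogonal projection of `h ∈ L²(Ω)` onto `A²(Ω)` : it lies in `A²(Ω)`, and
`h - f` is orthogonal to `A²(Ω)` in `L²(Ω)`. -/
def IsBergmanProjection (Ω : Set ℂ) (h f : ℂ → ℂ) : Prop :=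
  f ∈ bergmanSpace Ω ∧
    ∀ g ∈ bergmanSpace Ω, ∫ z in Ω, (h z - f z) * conj (g z) = 0

/-- `f` is a best approximation of `h ∈ L²(Ω)` by elements of `A²(Ω)`, in the `L²(Ω)` norm. -/
def IsBestBergmanApproximation (Ω : Set ℂ) (h f : ℂ → ℂ) : Prop :=
  f ∈ bergmanSpace Ω ∧
    ∀ g ∈ bergmanSpace Ω,
      eLpNorm (fun z => h z - f z) 2 (volume.restrict Ω) ≤
        eLpNorm (fun z => h z - g z) 2 (volume.restrict Ω)

/-- There is a possibly multivalued analytic function `F` in the open set `Ω` with `F' = f` whose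
real part is single valued, with `u = F + conj F` in `Ω` : near every point of `Ω` there is a
single-valued branch `F` with derivative `f` and `F + conj F = u`, where the function `u` is
globally defined. Two branches differ locally by an imaginary constant. -/
def IsTwiceRePrimitive (Ω : Set ℂ) (f : ℂ → ℂ) (u : ℂ → ℝ) : Prop :=
  ∀ z ∈ Ω, ∃ r > 0, Metric.ball z r ⊆ Ω ∧ ∃ F : ℂ → ℂ, ∀ w ∈ Metric.ball z r,
    HasDerivAt F (f w) w ∧ (u w : ℂ) = F w + conj (F w)

/-- `u` is a (classical) solution of the Dirichlet problem in `Ω` with boundary data `φ` :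
continuous on the closure, harmonic in `Ω`, equal to `φ` on the boundary. -/
structure IsDirichletSolution (Ω : Set ℂ) (φ u : ℂ → ℝ) : Prop where
  continuousOn : ContinuousOn u (closure Ω)
  harmonic : InnerProductSpace.HarmonicOnNhd u Ω
  boundary : ∀ ζ ∈ frontier Ω, u ζ = φ ζ

/-!
The Dirichlet problem in `Ω` with boundary data `‖z‖ ^ 2` has a unique solution `u`, and the
projection of `conj z` is its derivative `∂u`. Everything else in the theorem follows: `∂u` depends
only on `u`, a function `f` satisfies `IsTwiceRePrimitive Ω f v` exactly when `v` is harmonic and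
`f = ∂v` in `Ω` (`isTwiceRePrimitive_iff`), and a projection, like a best approximation, is
determined on `Ω` (`IsBergmanProjection.iff_eqOn`).

*The derivative is the projection* (`isBergmanProjection_wirtingerDeriv`). The function
`q = u - ‖z‖ ^ 2` is nonnegative, vanishes on the boundary, and `∂q = -(conj z - ∂u)`. If `q` had
compact support in `Ω`, integration by parts would give `∫ ∂q * conj g = 0` for holomorphic `g`, and
`∫ ‖∂q‖ ^ 2 = ∫ q`. As the boundary is arbitrary, `q` is replaced by `cutoff ε ∘ q`, which does have
compact support, and `ε` tends to `0`: Fatou's lemma gives `∂q ∈ L²`, and dominated convergence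
gives orthogonality.

*Existence of the solution* (`exists_isDirichletSolution`). As `‖z‖ ^ 2` is subharmonic, replacing
it successively by Poisson integrals in a sequence of discs that covers `Ω` infinitely often gives
an increasing sequence of subharmonic functions with harmonic limit `u ≥ ‖z‖ ^ 2`
(`exists_harmonic_limit`). Hence only an upper bound for `u` near each boundary point `ζ` is needed.
It comes from a barrier (`eventually_forall_locallySubmean_le`), and here the hypothesis that no
component of the complement is a point enters. The component of `ζ` contains a second point `ζ'`,
and a connected set containing `ζ` and `ζ'` and avoiding `Ω` forces `(z - ζ) / (z - ζ')` to have
a holomorphic logarithm `L` in `Ω` (`exists_log_div`). The map `L` is injective modulo `2πi`, so its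
image meets a vertical line in a set of length at most `2π`; the harmonic measure of that set in the
half-plane to its left, composed with `L`, is the barrier.
-/

section

open Metric Set Filter Topology Real InnerProductSpace

/-! ### Functions with the local submean property and the maximum principle -/

/-- `u` has the local submean value property in `W`: at each point of `W`, its value is at most
its average over every sufficiently small circle. For continuous functions on an open set this is
subharmonicity. -/
def LocallySubmean (W : Set ℂ) (u : ℂ → ℝ) : Prop :=
  ∀ z ∈ W, ∀ᶠ r in 𝓝[>] (0 : ℝ), u z ≤ circleAverage u z r

theorem IsOpen.eventually_pos_closedBall_subset {W : Set ℂ} (hW : IsOpen W) {z : ℂ} (hz : z ∈ W) :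
    ∀ᶠ r in 𝓝[>] (0 : ℝ), 0 < r ∧ closedBall z r ⊆ W := by
  obtain ⟨R, hR, hRW⟩ := Metric.isOpen_iff.1 hW z hz
  filter_upwards [Ioo_mem_nhdsGT hR] with r hr
  exact ⟨hr.1, (closedBall_subset_ball hr.2).trans hRW⟩

theorem ContinuousOn.circleIntegrable_of_closedBall_subset {W : Set ℂ} {u : ℂ → ℝ}
    (hu : ContinuousOn u W) {z : ℂ} {r : ℝ} (hr : 0 < r) (h : closedBall z r ⊆ W) :
    CircleIntegrable u z r :=
  (hu.mono (sphere_subset_closedBall.trans h)).circleIntegrable hr.le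

theorem LocallySubmean.mono {W V : Set ℂ} {u : ℂ → ℝ} (hu : LocallySubmean W u) (h : V ⊆ W) :
    LocallySubmean V u := fun z hz => hu z (h hz)

theorem InnerProductSpace.HarmonicOnNhd.eventually_circleAverage_eq {W : Set ℂ} (hW : IsOpen W)
    {u : ℂ → ℝ} (hu : HarmonicOnNhd u W) {z : ℂ} (hz : z ∈ W) :
    ∀ᶠ r in 𝓝[>] (0 : ℝ), circleAverage u z r = u z := by
  filter_upwards [hW.eventually_pos_closedBall_subset hz] with r hr
  exact HarmonicOnNhd.circleAverage_eq (hu.mono (by rw [abs_of_pos hr.1]; exact hr.2))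

theorem LocallySubmean.sub_harmonic {W : Set ℂ} (hW : IsOpen W) {u h : ℂ → ℝ}
    (hu : LocallySubmean W u) (huc : ContinuousOn u W) (hh : HarmonicOnNhd h W) :
    LocallySubmean W (u - h) := by
  intro z hz
  filter_upwards [hu z hz, hh.eventually_circleAverage_eq hW hz,
    hW.eventually_pos_closedBall_subset hz] with r h1 h2 h3
  rw [circleAverage_sub (huc.circleIntegrable_of_closedBall_subset h3.1 h3.2)
    (hh.continuousOn.circleIntegrable_of_closedBall_subset h3.1 h3.2), h2, Pi.sub_apply]
  linarith

theorem InnerProductSpace.HarmonicOnNhd.locallySubmean {W : Set ℂ} (hW : IsOpen W) {u : ℂ → ℝ}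
    (hu : HarmonicOnNhd u W) : LocallySubmean W u := fun _ hz =>
  (hu.eventually_circleAverage_eq hW hz).mono fun _ h => h.ge

/-- A circle average is strictly below an upper bound that is not attained at the rightmost
point of the circle. -/
theorem circleAverage_lt_of_le_of_lt {u : ℂ → ℝ} {z : ℂ} {r M : ℝ} (hr : 0 < r)
    (hu : ContinuousOn u (sphere z r)) (hle : ∀ w ∈ sphere z r, u w ≤ M) (hlt : u (z + r) < M) :
    circleAverage u z r < M := by
  have hmem : ∀ θ, circleMap z r θ ∈ sphere z r := circleMap_mem_sphere z hr.le
  have key : ∫ θ in (0 : ℝ)..2 * π, u (circleMap z r θ) < ∫ θ in (0 : ℝ)..2 * π, M := by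
    apply intervalIntegral.integral_lt_integral_of_continuousOn_of_le_of_exists_lt Real.two_pi_pos
    · exact hu.comp (by fun_prop) fun θ _ => hmem θ
    · exact continuousOn_const
    · exact fun θ _ => hle _ (hmem θ)
    · refine ⟨0, ⟨le_rfl, Real.two_pi_pos.le⟩, ?_⟩
      simpa [circleMap] using hlt
  rw [intervalIntegral.integral_const, sub_zero, smul_eq_mul] at key
  rw [circleAverage_def, smul_eq_mul, inv_mul_lt_iff₀ Real.two_pi_pos]
  exact key

/-- Maximum principle. If the maximum were positive, the set of maximum points would be compact,
and at its rightmost point the submean inequality would fail, since the right half of each small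
circle lies outside that set. -/
theorem LocallySubmean.nonpos {W : Set ℂ} (hW : IsOpen W) (hb : Bornology.IsBounded W)
    {d : ℂ → ℝ} (hd : LocallySubmean W d) (hc : ContinuousOn d W)
    (hbd : ∀ p ∈ frontier W, ∀ δ > 0, ∀ᶠ z in 𝓝[W] p, d z < δ) : ∀ z ∈ W, d z ≤ 0 := by
  by_contra! hcon
  obtain ⟨z₀, hz₀, hpos⟩ := hcon
  set S : Set ℂ := {z ∈ W | d z₀ ≤ d z}
  have hSW : S ⊆ W := fun z hz => hz.1
  have hSclosed : IsClosed S := by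
    refine isClosed_of_closure_subset fun p hp => ?_
    have hpW : p ∈ closure W := closure_mono hSW hp
    have hfr : ∃ᶠ z in 𝓝[W] p, d z₀ ≤ d z := by
      have := mem_closure_iff_frequently.1 hp
      rw [frequently_nhdsWithin_iff]
      exact this.mono fun z hz => ⟨hz.2, hz.1⟩
    by_cases hpin : p ∈ W
    · refine ⟨hpin, ?_⟩
      exact ge_of_tendsto_of_frequently (hc p hpin) hfr
    · have hpf : p ∈ frontier W := ⟨hpW, by rwa [hW.interior_eq]⟩
      obtain ⟨z, h1, h2⟩ := (hfr.and_eventually (hbd p hpf _ hpos)).exists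
      exact absurd h1 (not_le.2 h2)
  have hScompact : IsCompact S := isCompact_of_isClosed_isBounded hSclosed (hb.subset hSW)
  obtain ⟨z₁, hz₁, hmax⟩ := hScompact.exists_isMaxOn ⟨z₀, hz₀, le_rfl⟩ (hc.mono hSW)
  have hle : ∀ z ∈ W, d z ≤ d z₁ := by
    intro z hz
    by_cases h : d z₀ ≤ d z
    · exact hmax ⟨hz, h⟩
    · exact (not_le.1 h).le.trans hz₁.2
  have hT : IsCompact (S ∩ {z | d z = d z₁}) := by
    refine isCompact_of_isClosed_isBounded ?_ ((hb.subset hSW).subset inter_subset_left)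
    exact (hc.mono hSW).preimage_isClosed_of_isClosed hSclosed (isClosed_singleton (x := d z₁))
  obtain ⟨z₂, hz₂, hre⟩ := hT.exists_isMaxOn ⟨z₁, hz₁, rfl⟩ Complex.continuous_re.continuousOn
  obtain ⟨r, h1, h2, h3⟩ := ((hd z₂ (hSW hz₂.1)).and
    (hW.eventually_pos_closedBall_subset (hSW hz₂.1))).exists
  have hs : sphere z₂ r ⊆ W := sphere_subset_closedBall.trans h3
  have hmem : z₂ + r ∈ sphere z₂ r := by simp [abs_of_pos h2]
  have hlt : d (z₂ + r) < d z₁ := by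
    refine lt_of_le_of_ne (hle _ (hs hmem)) fun heq => ?_
    have : (z₂ + r).re ≤ z₂.re :=
      hre ⟨⟨hs hmem, by rw [heq]; exact hz₁.2⟩, heq⟩
    simp at this
    linarith
  have := circleAverage_lt_of_le_of_lt h2 (hc.mono hs) (fun w hw => hle w (hs hw)) hlt
  have h4 : d z₂ = d z₁ := hz₂.2
  linarith

theorem LocallySubmean.le_of_le_on_frontier {Ω : Set ℂ} (hΩ : IsOpen Ω)
    (hb : Bornology.IsBounded Ω) {s : ℂ → ℝ} (hs : ContinuousOn s (closure Ω))
    (hsub : LocallySubmean Ω s) {M : ℝ} (hM : ∀ p ∈ frontier Ω, s p ≤ M) :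
    ∀ z ∈ Ω, s z ≤ M := by
  intro z hz
  rw [← sub_nonpos]
  refine (hsub.sub_harmonic hΩ (hs.mono subset_closure) (harmonicOnNhd_const M)).nonpos hΩ hb
    ((hs.mono subset_closure).sub continuousOn_const) (fun p hp δ hδ => ?_) z hz
  have h4 : Tendsto (fun z => s z - M) (𝓝[Ω] p) (𝓝 (s p - M)) :=
    (((hs p hp.1).mono subset_closure).tendsto).sub_const M
  exact h4.eventually (gt_mem_nhds (by linarith [hM p hp]))

/-! ### The Poisson integral in a disc -/

/-- The Poisson integral at `w`, in the disc with centre `c` and radius `R`, of boundary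
values `φ`. -/
noncomputable def poissonIntegral (c : ℂ) (R : ℝ) (φ : ℂ → ℝ) (w : ℂ) : ℝ :=
  circleAverage (poissonKernel c w • φ) c R

theorem continuousOn_poissonKernel {c w : ℂ} {R : ℝ} (hw : w ∈ ball c R) :
    ContinuousOn (poissonKernel c w) (sphere c R) := by
  unfold poissonKernel
  refine ContinuousOn.div (by fun_prop) (by fun_prop) fun z hz h => ?_
  have : z = w := by simpa [sub_eq_zero] using h
  subst this
  simp only [mem_sphere, mem_ball] at hz hw
  exact hw.ne hz

theorem poissonKernel_nonneg {c w z : ℂ} {R : ℝ} (hw : w ∈ ball c R) (hz : z ∈ sphere c R) :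
    0 ≤ poissonKernel c w z := by
  rw [poissonKernel_def]
  rw [mem_ball_iff_norm] at hw
  rw [mem_sphere_iff_norm] at hz
  rw [hz]
  have : ‖w - c‖ ^ 2 ≤ R ^ 2 := by gcongr
  exact div_nonneg (by linarith) (by positivity)

theorem circleIntegrable_poissonKernel_smul {c w : ℂ} {R : ℝ} (hw : w ∈ ball c R) {φ : ℂ → ℝ}
    (hφ : CircleIntegrable φ c R) : CircleIntegrable (poissonKernel c w • φ) c R := by
  have hR : 0 < R := pos_of_mem_ball hw
  exact hφ.continuousOn_smul (by rw [abs_of_pos hR]; exact continuousOn_poissonKernel hw)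

theorem poissonIntegral_const {c w : ℂ} {R : ℝ} (hw : w ∈ ball c R) (a : ℝ) :
    poissonIntegral c R (fun _ => a) w = a :=
  (harmonicOnNhd_const (E := ℂ) (s := closedBall c R) a).circleAverage_poissonKernel_smul hw

/-- The Poisson integral is harmonic, being the real part of the integral of the holomorphic
Herglotz–Riesz kernel. -/
theorem harmonicOnNhd_poissonIntegral {c : ℂ} {R : ℝ} {φ : ℂ → ℝ} (hφ : CircleIntegrable φ c R) :
    HarmonicOnNhd (poissonIntegral c R φ) (ball c R) := by
  set g : ℂ → ℝ := fun ζ => φ (ζ + c)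
  have hg : CircleIntegrable g 0 R := by
    simpa [CircleIntegrable, g, circleMap, add_comm] using hφ
  have hgC : CircleIntegrable (fun ζ => (g ζ : ℂ)) 0 R := by
    simp only [CircleIntegrable, intervalIntegrable_iff] at hg ⊢
    exact Complex.ofRealCLM.integrable_comp hg
  have hA := analyticOnNhd_circleAverage_herglotzRieszKernel_smul hgC
  intro w hw
  have hmaps : ∀ w ∈ ball c R, w - c ∈ ball (0 : ℂ) R := fun w hw => by
    simpa [dist_eq_norm] using hw
  have hF : AnalyticAt ℂ (fun w => circleAverage
      (fun ζ => herglotzRieszKernel 0 (w - c) ζ • (g ζ : ℂ)) 0 R) w :=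
    AnalyticAt.fun_comp (f := fun w => w - c) (hA (w - c) (hmaps w hw)) (by fun_prop)
  refine (harmonicAt_congr_nhds ?_).1 hF.harmonicAt_re
  filter_upwards [isOpen_ball.mem_nhds hw] with w hw
  rw [re_circleAverage_herglotzRieszKernel_smul hg (hmaps w hw), poissonIntegral,
    ← circleAverage_map_add_const (c := c), poissonKernel_eq_re_herglotzRieszKernel]
  congr 1
  ext ζ
  simp [g, herglotzRieszKernel_add_const]

/-- Away from the boundary point `p`, the Poisson kernel is small, so only the values near `p`
count; this gives an explicit bound. -/
theorem abs_poissonIntegral_sub_le {c w p : ℂ} {R δ ε M : ℝ} {φ : ℂ → ℝ} (hw : w ∈ ball c R)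
    (hφ : ContinuousOn φ (sphere c R)) (hp : p ∈ sphere c R) (hδ : 0 < δ) (hε : 0 ≤ ε)
    (hM : ∀ z ∈ sphere c R, |φ z| ≤ M) (hnear : ∀ z ∈ sphere c R, ‖z - p‖ < δ → |φ z - φ p| ≤ ε)
    (hwp : ‖w - p‖ < δ / 2) :
    |poissonIntegral c R φ w - φ p| ≤ ε + 2 * M * ((R ^ 2 - ‖w - c‖ ^ 2) / (δ / 2) ^ 2) := by
  have hR : 0 < R := pos_of_mem_ball hw
  have hM0 : 0 ≤ M := (abs_nonneg _).trans (hM p hp)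
  have hφi : CircleIntegrable φ c R := hφ.circleIntegrable hR.le
  set B := 2 * M * ((R ^ 2 - ‖w - c‖ ^ 2) / (δ / 2) ^ 2) with hB
  have hwR : ‖w - c‖ < R := mem_ball_iff_norm.1 hw
  have hnum : 0 ≤ R ^ 2 - ‖w - c‖ ^ 2 := by
    have : ‖w - c‖ ^ 2 ≤ R ^ 2 := by gcongr
    linarith
  have hB0 : 0 ≤ B := by positivity
  -- pointwise comparison on the circle, to be averaged
  have hpt : ∀ z ∈ sphere c R, poissonKernel c w z * |φ z - φ p| ≤ ε * poissonKernel c w z + B := by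
    intro z hz
    have hk := poissonKernel_nonneg hw hz
    by_cases h : ‖z - p‖ < δ
    · nlinarith [hnear z hz h]
    · have hzw : δ / 2 ≤ ‖z - w‖ := by
        have := norm_sub_le_norm_sub_add_norm_sub z w p
        linarith
      have hk2 : poissonKernel c w z ≤ (R ^ 2 - ‖w - c‖ ^ 2) / (δ / 2) ^ 2 := by
        rw [poissonKernel_def, mem_sphere_iff_norm.1 hz, sub_sub_sub_cancel_right]
        gcongr
      have h2 : |φ z - φ p| ≤ 2 * M := by
        have := abs_sub (φ z) (φ p)
        linarith [hM z hz, hM p hp]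
      calc poissonKernel c w z * |φ z - φ p|
          ≤ ((R ^ 2 - ‖w - c‖ ^ 2) / (δ / 2) ^ 2) * (2 * M) := by gcongr
        _ = B := by rw [hB]; ring
        _ ≤ _ := by nlinarith
  have hk1 : circleAverage (poissonKernel c w) c R = 1 := by
    have := poissonIntegral_const hw 1
    rw [poissonIntegral] at this
    rw [← this]
    congr 1
    ext z
    simp
  have hki : CircleIntegrable (poissonKernel c w) c R :=
    (continuousOn_poissonKernel hw).circleIntegrable hR.le
  have hdiff : poissonIntegral c R φ w - φ p
      = circleAverage (poissonKernel c w • fun z => φ z - φ p) c R := by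
    have h1 : (poissonKernel c w • fun z => φ z - φ p)
        = poissonKernel c w • φ - poissonKernel c w • fun _ => φ p := by
      ext z
      simp [mul_sub]
    rw [h1, circleAverage_sub (circleIntegrable_poissonKernel_smul hw hφi)
      (circleIntegrable_poissonKernel_smul hw (continuousOn_const.circleIntegrable hR.le))]
    conv_lhs => rw [← poissonIntegral_const hw (φ p)]
    rfl
  have hcd : ContinuousOn (fun z => φ z - φ p) (sphere c R) := hφ.sub continuousOn_const
  calc |poissonIntegral c R φ w - φ p|
      ≤ circleAverage |poissonKernel c w • fun z => φ z - φ p| c R := by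
        rw [hdiff]; exact abs_circleAverage_le_circleAverage_abs
    _ ≤ circleAverage (ε • poissonKernel c w + fun _ => B) c R := by
        refine circleAverage_mono ?_ ?_ fun z hz => ?_
        · exact (((continuousOn_poissonKernel hw).smul hcd).abs).circleIntegrable hR.le
        · exact (((continuousOn_poissonKernel hw).const_smul ε).add
            continuousOn_const).circleIntegrable hR.le
        · rw [abs_of_pos hR] at hz
          simpa [abs_mul, abs_of_nonneg (poissonKernel_nonneg hw hz)] using hpt z hz
    _ = ε + B := by
        rw [circleAverage_add (hki.const_smul)
          (continuousOn_const.circleIntegrable hR.le), circleAverage_smul, hk1,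
          circleAverage_const]
        simp

theorem tendsto_poissonIntegral {c p : ℂ} {R : ℝ} {φ : ℂ → ℝ}
    (hφ : ContinuousOn φ (sphere c R)) (hp : p ∈ sphere c R) :
    Tendsto (poissonIntegral c R φ) (𝓝[ball c R] p) (𝓝 (φ p)) := by
  obtain ⟨M, hM⟩ := (isCompact_sphere c R).exists_bound_of_continuousOn hφ
  rw [Metric.tendsto_nhds]
  intro ε hε
  obtain ⟨δ, hδ, hnear⟩ := Metric.continuousOn_iff.1 hφ p hp (ε / 2) (by positivity)
  have hlim : Tendsto (fun w => 2 * M * ((R ^ 2 - ‖w - c‖ ^ 2) / (δ / 2) ^ 2))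
      (𝓝[ball c R] p) (𝓝 0) := by
    have : ContinuousAt (fun w => 2 * M * ((R ^ 2 - ‖w - c‖ ^ 2) / (δ / 2) ^ 2)) p := by fun_prop
    have h2 := this.tendsto
    rw [mem_sphere_iff_norm.1 hp] at h2
    simpa using h2.mono_left nhdsWithin_le_nhds
  have hclose : ∀ᶠ w in 𝓝[ball c R] p, ‖w - p‖ < δ / 2 := by
    filter_upwards [nhdsWithin_le_nhds (ball_mem_nhds p (half_pos hδ))] with w hw
    simpa [dist_eq_norm] using hw
  filter_upwards [self_mem_nhdsWithin, hclose, hlim.eventually (gt_mem_nhds (half_pos hε))]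
    with w h1 h2 h3
  rw [Real.dist_eq]
  have := abs_poissonIntegral_sub_le h1 hφ hp hδ (half_pos hε).le hM
    (fun z hz hzp => by
      have := hnear z hz (by rwa [dist_eq_norm])
      rw [Real.dist_eq] at this
      exact this.le) h2
  linarith

/-- The Poisson modification of `u` in a disc: inside the open disc, `u` is replaced by the Poisson
integral of its values on the boundary circle. -/
noncomputable def poissonModification (c : ℂ) (R : ℝ) (u : ℂ → ℝ) : ℂ → ℝ :=
  open Classical in fun z => if z ∈ ball c R then poissonIntegral c R u z else u z

theorem poissonModification_of_mem {c z : ℂ} {R : ℝ} {u : ℂ → ℝ} (hz : z ∈ ball c R) :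
    poissonModification c R u z = poissonIntegral c R u z := if_pos hz

theorem poissonModification_of_notMem {c z : ℂ} {R : ℝ} {u : ℂ → ℝ} (hz : z ∉ ball c R) :
    poissonModification c R u z = u z := if_neg hz

theorem continuousOn_poissonModification {c : ℂ} {R : ℝ} {u : ℂ → ℝ} {A : Set ℂ}
    (hu : ContinuousOn u A) (hA : closedBall c R ⊆ A) :
    ContinuousOn (poissonModification c R u) A := by
  intro z hz
  have hsA : sphere c R ⊆ A := sphere_subset_closedBall.trans hA
  by_cases hzb : z ∈ ball c R
  · have h1 : ContinuousAt (poissonIntegral c R u) z :=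
      (harmonicOnNhd_poissonIntegral ((hu.mono hsA).circleIntegrable
        (pos_of_mem_ball hzb).le) z hzb).1.continuousAt
    refine (h1.congr ?_).continuousWithinAt
    filter_upwards [isOpen_ball.mem_nhds hzb] with w hw using (poissonModification_of_mem hw).symm
  · have hval := poissonModification_of_notMem (u := u) hzb
    have hout : Tendsto (poissonModification c R u) (𝓝[A ∩ (ball c R)ᶜ] z) (𝓝 (u z)) := by
      refine ((hu z hz).mono inter_subset_left).tendsto.congr' ?_
      filter_upwards [self_mem_nhdsWithin] with w hw using (poissonModification_of_notMem hw.2).symm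
    have hin : Tendsto (poissonModification c R u) (𝓝[A ∩ ball c R] z) (𝓝 (u z)) := by
      by_cases hzs : z ∈ sphere c R
      · refine ((tendsto_poissonIntegral (hu.mono hsA) hzs).congr' ?_).mono_left
          (nhdsWithin_mono z inter_subset_right)
        filter_upwards [self_mem_nhdsWithin] with w hw using (poissonModification_of_mem hw).symm
      · have hzc : z ∉ closure (ball c R) := fun h => by
          have h2 := closure_ball_subset_closedBall h
          rw [← ball_union_sphere] at h2
          exact h2.elim hzb hzs
        have : 𝓝[A ∩ ball c R] z = ⊥ := by
          rw [← notMem_closure_iff_nhdsWithin_eq_bot]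
          exact fun h => hzc (closure_mono inter_subset_right h)
        rw [this]
        exact tendsto_bot
    rw [ContinuousWithinAt, hval]
    have hun : A = A ∩ ball c R ∪ A ∩ (ball c R)ᶜ := by
      rw [← inter_union_distrib_left, union_compl_self, inter_univ]
    rw [hun, nhdsWithin_union]
    exact hin.sup hout

/-- A subharmonic function increases under Poisson modification, by the maximum principle in the
disc. -/
theorem LocallySubmean.le_poissonModification {W : Set ℂ} {c : ℂ} {R : ℝ}
    {u : ℂ → ℝ} (hu : LocallySubmean W u) (hc : ContinuousOn u W)
    (hR : closedBall c R ⊆ W) (z : ℂ) : u z ≤ poissonModification c R u z := by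
  by_cases hz : z ∈ ball c R
  swap
  · rw [poissonModification_of_notMem hz]
  have hR0 := pos_of_mem_ball hz
  have hbW : ball c R ⊆ W := ball_subset_closedBall.trans hR
  have hcont : ContinuousOn u (closedBall c R) := hc.mono hR
  have hh := harmonicOnNhd_poissonIntegral
    ((hcont.mono sphere_subset_closedBall).circleIntegrable hR0.le)
  have hmod := continuousOn_poissonModification hcont subset_rfl
  rw [poissonModification_of_mem hz, ← sub_nonpos]
  refine ((hu.mono hbW).sub_harmonic isOpen_ball (hc.mono hbW) hh).nonpos isOpen_ball
    isBounded_ball ((hc.mono hbW).sub hh.continuousOn) (fun p hp δ hδ => ?_) z hz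
  rw [frontier_ball c hR0.ne'] at hp
  have h1 : Tendsto u (𝓝[ball c R] p) (𝓝 (u p)) :=
    ((hcont p (sphere_subset_closedBall hp)).mono ball_subset_closedBall).tendsto
  have h2 := h1.sub (tendsto_poissonIntegral (hcont.mono sphere_subset_closedBall) hp)
  rw [sub_self] at h2
  exact h2.eventually (gt_mem_nhds hδ)

theorem LocallySubmean.poissonModification {W : Set ℂ} (hW : IsOpen W) {c : ℂ} {R : ℝ}
    {u : ℂ → ℝ} (hu : LocallySubmean W u) (hc : ContinuousOn u W)
    (hR : closedBall c R ⊆ W) : LocallySubmean W (poissonModification c R u) := by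
  intro z hz
  by_cases hzb : z ∈ ball c R
  · have hh := harmonicOnNhd_poissonIntegral
      ((hc.mono (sphere_subset_closedBall.trans hR)).circleIntegrable (pos_of_mem_ball hzb).le)
    have hh2 : HarmonicOnNhd (_root_.poissonModification c R u) (ball c R) := fun w hw => by
      refine (harmonicAt_congr_nhds ?_).1 (hh w hw)
      filter_upwards [isOpen_ball.mem_nhds hw] with v hv using (poissonModification_of_mem hv).symm
    exact hh2.locallySubmean isOpen_ball z hzb
  · filter_upwards [hu z hz, hW.eventually_pos_closedBall_subset hz] with r h1 h2
    rw [poissonModification_of_notMem hzb]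
    refine h1.trans (circleAverage_mono (hc.circleIntegrable_of_closedBall_subset h2.1 h2.2)
      ((continuousOn_poissonModification hc hR).circleIntegrable_of_closedBall_subset h2.1 h2.2)
      fun w _ => hu.le_poissonModification hc hR w)

/-! ### Balayage: a harmonic majorant as a limit of Poisson modifications -/

theorem IsOpen.exists_seq_closedBall_subset {Ω : Set ℂ} (hΩ : IsOpen Ω) (hne : Ω.Nonempty) :
    ∃ D : ℕ → ℂ × ℝ, (∀ k, closedBall (D k).1 (D k).2 ⊆ Ω) ∧
      ∀ z ∈ Ω, ∃ k, z ∈ ball (D k).1 (D k).2 := by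
  have h : ∀ z : ℂ, ∃ r : ℝ, z ∈ Ω → 0 < r ∧ closedBall z r ⊆ Ω := fun z => by
    by_cases hz : z ∈ Ω
    · obtain ⟨r, hr⟩ := (hΩ.eventually_pos_closedBall_subset hz).exists
      exact ⟨r, fun _ => hr⟩
    · exact ⟨0, fun h => absurd h hz⟩
  choose r hr using h
  obtain ⟨t, htΩ, htc, hcov⟩ := TopologicalSpace.countable_cover_nhdsWithin
    (f := fun z => ball z (r z)) (s := Ω)
    fun z hz => mem_nhdsWithin_of_mem_nhds (ball_mem_nhds z (hr z hz).1)
  have htne : t.Nonempty := by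
    obtain ⟨z, hz⟩ := hne
    obtain ⟨x, hx, -⟩ := mem_iUnion₂.1 (hcov hz)
    exact ⟨x, hx⟩
  obtain ⟨f, rfl⟩ := htc.exists_eq_range htne
  refine ⟨fun k => (f k, r (f k)), fun k => (hr _ (htΩ ⟨k, rfl⟩)).2, fun z hz => ?_⟩
  obtain ⟨x, ⟨k, rfl⟩, hk⟩ := mem_iUnion₂.1 (hcov hz)
  exact ⟨k, hk⟩

theorem circleIntegrable_of_tendsto {c : ℂ} {R B : ℝ} (hR : 0 ≤ R) {s : ℕ → ℂ → ℝ} {u : ℂ → ℝ}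
    (hs : ∀ n, ContinuousOn (s n) (sphere c R)) (hB : ∀ n, ∀ z ∈ sphere c R, |s n z| ≤ B)
    (hlim : ∀ z ∈ sphere c R, Tendsto (fun n => s n z) atTop (𝓝 (u z))) :
    CircleIntegrable u c R := by
  have hmem : ∀ θ, circleMap c R θ ∈ sphere c R := circleMap_mem_sphere c hR
  rw [CircleIntegrable, intervalIntegrable_iff]
  refine Measure.integrableOn_of_bounded (M := B)
    (by rw [uIoc_of_le two_pi_pos.le]; exact measure_Ioc_lt_top.ne) ?_ ?_
  · refine aestronglyMeasurable_of_tendsto_ae atTop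
      (f := fun n θ => s n (circleMap c R θ)) (fun n => ?_) (ae_of_all _ fun θ => hlim _ (hmem θ))
    exact ((hs n).comp_continuous (by fun_prop) hmem).aestronglyMeasurable
  · exact ae_of_all _ fun θ => le_of_tendsto (hlim _ (hmem θ)).abs
      (Eventually.of_forall fun n => hB n _ (hmem θ))

theorem tendsto_poissonIntegral_of_tendsto {c w : ℂ} {R B : ℝ} (hw : w ∈ ball c R)
    {s : ℕ → ℂ → ℝ} {u : ℂ → ℝ}
    (hs : ∀ n, ContinuousOn (s n) (sphere c R)) (hB : ∀ n, ∀ z ∈ sphere c R, |s n z| ≤ B)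
    (hlim : ∀ z ∈ sphere c R, Tendsto (fun n => s n z) atTop (𝓝 (u z))) :
    Tendsto (fun n => poissonIntegral c R (s n) w) atTop (𝓝 (poissonIntegral c R u w)) := by
  have hR := (pos_of_mem_ball hw).le
  have hmem : ∀ θ, circleMap c R θ ∈ sphere c R := circleMap_mem_sphere c hR
  have hk : Continuous fun θ => poissonKernel c w (circleMap c R θ) :=
    (continuousOn_poissonKernel hw).comp_continuous (by fun_prop) hmem
  simp only [poissonIntegral, circleAverage_def]
  refine Tendsto.const_smul ?_ _
  refine intervalIntegral.tendsto_integral_filter_of_dominated_convergence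
    (fun θ => poissonKernel c w (circleMap c R θ) * B) ?_ ?_ ?_ ?_
  · refine Eventually.of_forall fun n => ?_
    exact (hk.smul ((hs n).comp_continuous (by fun_prop) hmem)).aestronglyMeasurable
  · refine Eventually.of_forall fun n => ae_of_all _ fun θ _ => ?_
    have h0 := poissonKernel_nonneg hw (hmem θ)
    simp only [Pi.smul_apply', smul_eq_mul, norm_mul, Real.norm_eq_abs, abs_of_nonneg h0]
    exact mul_le_mul_of_nonneg_left (hB n _ (hmem θ)) h0
  · exact (hk.mul continuous_const).intervalIntegrable _ _
  · exact ae_of_all _ fun θ _ => (hlim _ (hmem θ)).const_smul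
      (poissonKernel c w (circleMap c R θ))

/-- The sequence of successive Poisson modifications of `φ` in the discs `D k`. Each disc is used
infinitely often, the `n`-th step using the disc whose index is the first entry of the pair
that `n` encodes. -/
noncomputable def balayage (D : ℕ → ℂ × ℝ) (φ : ℂ → ℝ) : ℕ → ℂ → ℝ
  | 0 => φ
  | n + 1 => poissonModification (D n.unpair.1).1 (D n.unpair.1).2 (balayage D φ n)

theorem balayage_properties {Ω : Set ℂ} (hΩ : IsOpen Ω) {D : ℕ → ℂ × ℝ}
    (hD : ∀ k, closedBall (D k).1 (D k).2 ⊆ Ω) {φ : ℂ → ℝ} (hφ : ContinuousOn φ (closure Ω))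
    (hsub : LocallySubmean Ω φ) (n : ℕ) :
    ContinuousOn (balayage D φ n) (closure Ω) ∧ LocallySubmean Ω (balayage D φ n) ∧
      ∀ z ∉ Ω, balayage D φ n z = φ z := by
  induction n with
  | zero => exact ⟨hφ, hsub, fun _ _ => rfl⟩
  | succ n ih =>
    obtain ⟨h1, h2, h3⟩ := ih
    refine ⟨continuousOn_poissonModification h1 ((hD _).trans subset_closure),
      h2.poissonModification hΩ (h1.mono subset_closure) (hD _), fun z hz => ?_⟩
    rw [balayage, poissonModification_of_notMem, h3 z hz]
    exact fun h => hz (hD _ (ball_subset_closedBall h))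

/-- A continuous function on the closure of a bounded open set `Ω`, subharmonic in `Ω`, has a
harmonic majorant in `Ω` that is a pointwise limit of subharmonic functions with the same boundary
values. -/
theorem exists_harmonic_limit {Ω : Set ℂ} (hΩ : IsOpen Ω) (hne : Ω.Nonempty)
    (hb : Bornology.IsBounded Ω) {φ : ℂ → ℝ} (hφ : ContinuousOn φ (closure Ω))
    (hsub : LocallySubmean Ω φ) :
    ∃ (u : ℂ → ℝ) (s : ℕ → ℂ → ℝ), HarmonicOnNhd u Ω ∧ (∀ z, φ z ≤ u z) ∧
      (∀ z ∉ Ω, u z = φ z) ∧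
      (∀ n, ContinuousOn (s n) (closure Ω) ∧ LocallySubmean Ω (s n) ∧ ∀ z ∉ Ω, s n z = φ z) ∧
      ∀ z, Tendsto (fun n => s n z) atTop (𝓝 (u z)) := by
  obtain ⟨D, hD, hcov⟩ := hΩ.exists_seq_closedBall_subset hne
  set s := balayage D φ with hs
  have hprop := balayage_properties hΩ hD hφ hsub
  have hmono : ∀ z, Monotone fun n => s n z := fun z => monotone_nat_of_le_succ fun n =>
    (hprop n).2.1.le_poissonModification ((hprop n).1.mono subset_closure) (hD _) z
  obtain ⟨M, hM⟩ := hb.isCompact_closure.exists_bound_of_continuousOn hφ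
  have hle : ∀ n, ∀ z ∈ Ω, s n z ≤ M := fun n =>
    (hprop n).2.1.le_of_le_on_frontier hΩ hb (hprop n).1 fun p hp => by
      rw [hΩ.frontier_eq] at hp
      rw [(hprop n).2.2 p hp.2]
      exact (abs_le.1 (hM p hp.1)).2
  have hbdd : ∀ z, BddAbove (range fun n => s n z) := by
    intro z
    by_cases hz : z ∈ Ω
    · exact ⟨M, by rintro _ ⟨n, rfl⟩; exact hle n z hz⟩
    · exact ⟨φ z, by rintro _ ⟨n, rfl⟩; exact ((hprop n).2.2 z hz).le⟩
  set u : ℂ → ℝ := fun z => ⨆ n, s n z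
  have hlim : ∀ z, Tendsto (fun n => s n z) atTop (𝓝 (u z)) := fun z =>
    tendsto_atTop_ciSup (hmono z) (hbdd z)
  refine ⟨u, s, fun z hz => ?_, fun z => le_ciSup (hbdd z) 0, fun z hz => ?_, hprop, hlim⟩
  · obtain ⟨k, hk⟩ := hcov z hz
    have hsph : sphere (D k).1 (D k).2 ⊆ Ω := sphere_subset_closedBall.trans (hD k)
    have hcont : ∀ n, ContinuousOn (s n) (sphere (D k).1 (D k).2) := fun n =>
      (hprop n).1.mono (hsph.trans subset_closure)
    have hB : ∀ n, ∀ z ∈ sphere (D k).1 (D k).2, |s n z| ≤ M := fun n z hz => by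
      refine abs_le.2 ⟨?_, hle n z (hsph hz)⟩
      exact (abs_le.1 (hM z (subset_closure (hsph hz)))).1.trans (hmono z (Nat.zero_le n))
    have hR := pos_of_mem_ball hk
    have hui := circleIntegrable_of_tendsto hR.le hcont hB fun z _ => hlim z
    refine (harmonicAt_congr_nhds ?_).1 (harmonicOnNhd_poissonIntegral hui z hk)
    filter_upwards [isOpen_ball.mem_nhds hk] with w hw
    -- along the steps that use the disc `D k`, the limit is computed in two ways
    have hpair : Tendsto (fun j => Nat.pair k j) atTop atTop :=
      tendsto_atTop_mono (fun j => Nat.right_le_pair k j) tendsto_id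
    have h1 := (tendsto_poissonIntegral_of_tendsto hw hcont hB fun z _ => hlim z).comp hpair
    have h2 := (hlim w).comp ((tendsto_add_atTop_nat 1).comp hpair)
    refine tendsto_nhds_unique h1 (h2.congr fun j => ?_)
    simp only [Function.comp_apply, hs, balayage, Nat.unpair_pair]
    exact poissonModification_of_mem hw
  · exact tendsto_nhds_unique (hlim z)
      (tendsto_const_nhds.congr fun n => ((hprop n).2.2 z hz).symm)

/-! ### A branch of the logarithm off a connected set -/

/-- If `a` and `b` lie in a preconnected set `K`, then `(z - a) / (z - b)` has a holomorphic
logarithm on the set of points at distance more than `δ` from `K`: join `a` to `b` by a finite chain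
in `K` with steps shorter than `δ`. For one such step the quotient is in the disc with centre `1`
and radius `1`, where the principal branch is available. -/
theorem exists_log_div_of_lt_infDist {K : Set ℂ} (hK : IsPreconnected K) {δ : ℝ} (hδ : 0 < δ)
    {a b : ℂ} (ha : a ∈ K) (hb : b ∈ K) :
    ∃ L : ℂ → ℂ, DifferentiableOn ℂ L {z | δ < infDist z K} ∧
      ∀ z, δ < infDist z K → Complex.exp (L z) = (z - a) / (z - b) := by
  have hne : ∀ z, δ < infDist z K → ∀ k ∈ K, z - k ≠ 0 := fun z hz k hk h => by
    have := infDist_le_dist_of_mem (x := z) hk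
    rw [dist_eq_norm, h, norm_zero] at this
    linarith
  refine hK.induction₂ (fun a b => ∃ L : ℂ → ℂ, DifferentiableOn ℂ L {z | δ < infDist z K} ∧
      ∀ z, δ < infDist z K → Complex.exp (L z) = (z - a) / (z - b)) ?_ ?_ ?_ ha hb
  · intro x hx
    filter_upwards [self_mem_nhdsWithin, nhdsWithin_le_nhds (ball_mem_nhds x hδ)] with y hy hyx
    have hslit : ∀ z, δ < infDist z K → (z - x) / (z - y) ∈ Complex.slitPlane := by
      intro z hz
      have h1 : (z - x) / (z - y) = 1 + (y - x) / (z - y) := by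
        field_simp [hne z hz y hy]
        ring
      rw [h1]
      apply Complex.mem_slitPlane_of_norm_lt_one
      have h2 := infDist_le_dist_of_mem (x := z) hy
      rw [dist_eq_norm] at h2
      rw [mem_ball, dist_eq_norm] at hyx
      rw [norm_div, div_lt_one (by linarith)]
      linarith
    refine ⟨fun z => Complex.log ((z - x) / (z - y)), fun z hz => ?_, fun z hz => ?_⟩
    · have hq : DifferentiableAt ℂ (fun z => (z - x) / (z - y)) z :=
        DifferentiableAt.fun_div (by fun_prop) (by fun_prop) (hne z hz y hy)
      exact (hq.clog (hslit z hz)).differentiableWithinAt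
    · exact Complex.exp_log (Complex.slitPlane_ne_zero (hslit z hz))
  · rintro x y w - hy - ⟨L₁, h1, h2⟩ ⟨L₂, h3, h4⟩
    refine ⟨fun z => L₁ z + L₂ z, h1.add h3, fun z hz => ?_⟩
    rw [Complex.exp_add, h2 z hz, h4 z hz, div_mul_div_cancel₀ (hne z hz y hy)]
  · rintro x y - - ⟨L, h1, h2⟩
    refine ⟨fun z => -L z, h1.neg, fun z hz => ?_⟩
    rw [Complex.exp_neg, h2 z hz, inv_div]

theorem hasDerivAt_of_exp_eq {L f : ℂ → ℂ} {U : Set ℂ} (hU : IsOpen U)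
    (hL : DifferentiableOn ℂ L U) (h : ∀ z ∈ U, Complex.exp (L z) = f z) {z : ℂ} (hz : z ∈ U) :
    HasDerivAt L (deriv f z / f z) z := by
  have hd := (hL.differentiableAt (hU.mem_nhds hz)).hasDerivAt
  have he : (fun w => Complex.exp (L w)) =ᶠ[𝓝 z] f := by
    filter_upwards [hU.mem_nhds hz] with w hw using h w hw
  have h1 := (hd.cexp).congr_of_eventuallyEq he.symm
  have h2 : deriv L z = deriv f z / f z := by
    rw [h1.deriv, h z hz, mul_div_cancel_left₀]
    rw [← h z hz]
    exact Complex.exp_ne_zero _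
  rwa [h2] at hd

/-- The logarithms on the sets `{z ∈ Ω | δ < infDist z K}`, normalised at a base point, agree with
each other on the components containing that point, and these components exhaust the connected
open set `Ω` as `δ → 0`. -/
theorem exists_log_div {Ω K : Set ℂ} (hΩ : IsOpen Ω) (hconn : IsConnected Ω)
    (hK : IsPreconnected K) (hKc : IsClosed K) (hdisj : Disjoint Ω K) {a b : ℂ} (ha : a ∈ K)
    (hb : b ∈ K) :
    ∃ L : ℂ → ℂ, DifferentiableOn ℂ L Ω ∧ ∀ z ∈ Ω, Complex.exp (L z) = (z - a) / (z - b) := by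
  obtain ⟨z₀, hz₀⟩ := hconn.nonempty
  set f : ℂ → ℂ := fun z => (z - a) / (z - b)
  have hf0 : f z₀ ≠ 0 := by
    refine div_ne_zero (sub_ne_zero.2 ?_) (sub_ne_zero.2 ?_)
    · rintro rfl
      exact disjoint_left.1 hdisj hz₀ ha
    · rintro rfl
      exact disjoint_left.1 hdisj hz₀ hb
  set U : ℕ → Set ℂ := fun n => Ω ∩ {z | 1 / ((n : ℝ) + 1) < infDist z K}
  have hUo : ∀ n, IsOpen (U n) := fun n =>
    hΩ.inter (isOpen_lt continuous_const (continuous_infDist_pt K))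
  have hUmono : Monotone U := fun n m hnm => by
    refine inter_subset_inter_right _ (ofPred_subset_ofPred.2 fun z hz => ?_)
    exact lt_of_le_of_lt (one_div_le_one_div_of_le (by positivity) (by gcongr)) hz
  choose L₀ hL₀ hL₀e using fun n : ℕ =>
    exists_log_div_of_lt_infDist hK (δ := 1 / ((n : ℝ) + 1)) (by positivity) ha hb
  set V : ℕ → Set ℂ := fun n => connectedComponentIn (U n) z₀
  have hVo : ∀ n, IsOpen (V n) := fun n => (hUo n).connectedComponentIn
  have hVU : ∀ n, V n ⊆ U n := fun n => connectedComponentIn_subset _ _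
  set L : ℕ → ℂ → ℂ := fun n z => L₀ n z - L₀ n z₀ + Complex.log (f z₀) with hLdef
  have hLd : ∀ n, DifferentiableOn ℂ (L n) (V n) := fun n =>
    (((hL₀ n).mono fun z hz => (hVU n hz).2).sub_const _).add_const _
  have hz₀V : ∀ n, (V n).Nonempty → z₀ ∈ V n := fun n hn =>
    mem_connectedComponentIn (connectedComponentIn_nonempty_iff.1 hn)
  have hLe : ∀ n, ∀ z ∈ V n, Complex.exp (L n z) = f z := fun n z hz => by
    have h0 := hz₀V n ⟨z, hz⟩
    rw [Complex.exp_add, Complex.exp_sub, Complex.exp_log hf0, hL₀e n z (hVU n hz).2,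
      hL₀e n z₀ (hVU n h0).2]
    exact div_mul_cancel₀ _ hf0
  have hagree' : ∀ n m, n ≤ m → ∀ z ∈ V n, L n z = L m z := by
    intro n m hnm z hz
    have hVV : V n ⊆ V m := connectedComponentIn_mono _ (hUmono hnm)
    have h0 := hz₀V n ⟨z, hz⟩
    refine (hVo n).eqOn_of_deriv_eq isPreconnected_connectedComponentIn (hLd n)
      ((hLd m).mono hVV) (fun w hw => ?_) h0 (by simp [hLdef]) hz
    rw [(hasDerivAt_of_exp_eq (hVo n) (hLd n) (hLe n) hw).deriv,
      (hasDerivAt_of_exp_eq (hVo m) (hLd m) (hLe m) (hVV hw)).deriv]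
  have hagree : ∀ n m z, z ∈ V n → z ∈ V m → L n z = L m z := by
    intro n m z hn hm
    rcases le_total n m with h | h
    · exact hagree' n m h z hn
    · exact (hagree' m n h z hm).symm
  have hexh : ∀ z, ∃ n, z ∈ Ω → z ∈ V n := by
    intro z
    by_cases hz : z ∈ Ω
    swap
    · exact ⟨0, fun h => absurd h hz⟩
    obtain ⟨γ, hγ⟩ := (hΩ.isConnected_iff_isPathConnected.1 hconn).joinedIn z₀ hz₀ z hz
    have hcomp : IsCompact (range γ) := isCompact_range γ.continuous
    obtain ⟨_, ⟨t, rfl⟩, ht⟩ := hcomp.exists_isMinOn (range_nonempty γ)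
      (continuous_infDist_pt K).continuousOn
    have hpos : 0 < infDist (γ t) K :=
      (hKc.notMem_iff_infDist_pos ⟨a, ha⟩).1 (disjoint_left.1 hdisj (hγ t))
    obtain ⟨n, hn⟩ := exists_nat_one_div_lt hpos
    refine ⟨n, fun _ => ?_⟩
    have hsub : range γ ⊆ U n := by
      rintro _ ⟨t', rfl⟩
      exact ⟨hγ t', hn.trans_le (ht ⟨t', rfl⟩)⟩
    exact (isPreconnected_range γ.continuous).subset_connectedComponentIn
      ⟨0, γ.source⟩ hsub ⟨1, γ.target⟩
  choose N hN using hexh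
  refine ⟨fun z => L (N z) z, fun z hz => ?_, fun z hz => hLe _ z (hN z hz)⟩
  have hd := (hLd (N z)).differentiableAt ((hVo _).mem_nhds (hN z hz))
  refine (hd.congr_of_eventuallyEq ?_).differentiableWithinAt
  filter_upwards [(hVo _).mem_nhds (hN z hz)] with w hw
  exact hagree _ _ w (hN w (hVU _ hw).1) hw

/-! ### A barrier at a boundary point in a nontrivial component of the complement -/

theorem isOpen_image_of_exp_eq_div {Ω : Set ℂ} (hΩ : IsOpen Ω) {a b : ℂ} (hab : a ≠ b)
    (hbΩ : b ∉ Ω) {L : ℂ → ℂ} (hL : DifferentiableOn ℂ L Ω)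
    (he : ∀ z ∈ Ω, Complex.exp (L z) = (z - a) / (z - b)) : IsOpen (L '' Ω) := by
  rw [isOpen_iff_mem_nhds]
  rintro _ ⟨z, hz, rfl⟩
  have hzb : z - b ≠ 0 := sub_ne_zero.2 fun h => hbΩ (h ▸ hz)
  have hd := hasDerivAt_of_exp_eq hΩ hL he hz
  have hf : HasDerivAt (fun z => (z - a) / (z - b))
      ((1 * (z - b) - (z - a) * 1) / (z - b) ^ 2) z :=
    ((hasDerivAt_id z).sub_const a).fun_div ((hasDerivAt_id z).sub_const b) hzb
  have hne : deriv L z ≠ 0 := by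
    rw [hd.deriv, hf.deriv, ← he z hz]
    refine div_ne_zero (div_ne_zero ?_ (pow_ne_zero 2 hzb)) (Complex.exp_ne_zero _)
    have : 1 * (z - b) - (z - a) * 1 = a - b := by ring
    rw [this]
    exact sub_ne_zero.2 hab
  have hs : HasStrictDerivAt L (deriv L z) z :=
    ((hL.analyticOnNhd hΩ) z hz).hasStrictDerivAt
  rw [← hs.map_nhds_eq hne]
  exact image_mem_map (hΩ.mem_nhds hz)

/-- The branch `L` is injective modulo `2πi`, so a vertical line meets its image in a set of length
at most `2π`. -/
theorem volume_vertical_slice_le {Ω : Set ℂ} (hΩ : IsOpen Ω) {a b : ℂ} (hab : a ≠ b)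
    (hbΩ : b ∉ Ω) {L : ℂ → ℂ} (hL : DifferentiableOn ℂ L Ω)
    (he : ∀ z ∈ Ω, Complex.exp (L z) = (z - a) / (z - b)) (c : ℝ) :
    IsOpen {t : ℝ | (c + t * Complex.I : ℂ) ∈ L '' Ω} ∧
      volume {t : ℝ | (c + t * Complex.I : ℂ) ∈ L '' Ω} ≤ ENNReal.ofReal (2 * π) := by
  set E : Set ℝ := {t : ℝ | (c + t * Complex.I : ℂ) ∈ L '' Ω}
  have hEo : IsOpen E :=
    (isOpen_image_of_exp_eq_div hΩ hab hbΩ hL he).preimage (by fun_prop)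
  refine ⟨hEo, ?_⟩
  by_contra! hlt
  have hlt' : volume (Ioc (0 : ℝ) (0 + 2 * π)) < volume E := by simpa using hlt
  obtain ⟨x, y, hxy, hd⟩ := exists_pair_mem_lattice_not_disjoint_vadd
    (isAddFundamentalDomain_Ioc Real.two_pi_pos 0) hEo.measurableSet.nullMeasurableSet hlt'
  obtain ⟨_, ⟨t, ⟨z, hz, hzt⟩, rfl⟩, ⟨t', ⟨z', hz', hzt'⟩, htt'⟩⟩ := not_disjoint_iff.1 hd
  obtain ⟨x, m, rfl⟩ := x
  obtain ⟨y, n, rfl⟩ := y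
  have htt : n * (2 * π) + t' = m * (2 * π) + t := by
    simpa [AddSubgroup.vadd_def] using htt'
  have hLL : L z' = L z + ((m - n : ℤ) : ℂ) * (2 * π * Complex.I) := by
    have h1 : (t' : ℂ) = m * (2 * π) - n * (2 * π) + t := by
      have : t' = m * (2 * π) - n * (2 * π) + t := by linarith
      exact_mod_cast this
    rw [hzt, hzt', h1]
    push_cast
    ring
  have hexp : (z - a) / (z - b) = (z' - a) / (z' - b) := by
    rw [← he z hz, ← he z' hz', hLL, Complex.exp_add, Complex.exp_int_mul_two_pi_mul_I, mul_one]
  have hzb : z - b ≠ 0 := sub_ne_zero.2 fun h => hbΩ (h ▸ hz)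
  have hzb' : z' - b ≠ 0 := sub_ne_zero.2 fun h => hbΩ (h ▸ hz')
  have hzz : z = z' := by
    rw [div_eq_div_iff hzb hzb'] at hexp
    have h2 : (a - b) * (z - z') = 0 := by linear_combination hexp
    rcases mul_eq_zero.1 h2 with h | h
    · exact absurd (sub_eq_zero.1 h) hab
    · exact sub_eq_zero.1 h
  subst hzz
  have hmn : ((m - n : ℤ) : ℂ) = 0 := by
    have h3 : ((m - n : ℤ) : ℂ) * (2 * π * Complex.I) = 0 := by linear_combination -hLL
    exact (mul_eq_zero.1 h3).resolve_right Complex.two_pi_I_ne_zero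
  have : m = n := sub_eq_zero.1 (by exact_mod_cast hmn)
  exact hxy (by subst this; rfl)

/-- The holomorphic function on the half-plane `Re w < c` whose real part is `π` times the harmonic
measure of the subset `c + iE` of the boundary line. -/
noncomputable def halfPlaneCauchy (c : ℝ) (E : Set ℝ) (w : ℂ) : ℂ :=
  ∫ t in E, ((c : ℂ) - w + t * Complex.I)⁻¹

theorem le_norm_halfPlane {c : ℝ} (w : ℂ) (t : ℝ) :
    c - w.re ≤ ‖(c : ℂ) - w + t * Complex.I‖ := by
  have := Complex.re_le_norm ((c : ℂ) - w + t * Complex.I)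
  simpa using this

theorem norm_inv_halfPlane_le {c x : ℝ} (hx : 0 < x) {w : ℂ} (hw : x ≤ c - w.re) (t : ℝ) :
    ‖((c : ℂ) - w + t * Complex.I)⁻¹‖ ≤ x⁻¹ := by
  rw [norm_inv]
  exact inv_anti₀ hx (hw.trans (le_norm_halfPlane w t))

theorem halfPlane_ne_zero {c : ℝ} {w : ℂ} (hw : w.re < c) (t : ℝ) :
    (c : ℂ) - w + t * Complex.I ≠ 0 := by
  rw [← norm_pos_iff]
  exact (sub_pos.2 hw).trans_le (le_norm_halfPlane w t)

theorem continuous_inv_halfPlane {c : ℝ} {w : ℂ} (hw : w.re < c) :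
    Continuous fun t : ℝ => ((c : ℂ) - w + t * Complex.I)⁻¹ :=
  Continuous.inv₀ (by fun_prop) (halfPlane_ne_zero hw)

theorem integrableOn_inv_halfPlane {c : ℝ} {E : Set ℝ} (hE : volume E ≠ ⊤) {w : ℂ}
    (hw : w.re < c) : IntegrableOn (fun t : ℝ => ((c : ℂ) - w + t * Complex.I)⁻¹) E :=
  Measure.integrableOn_of_bounded (M := (c - w.re)⁻¹) hE
    (continuous_inv_halfPlane hw).aestronglyMeasurable
    (ae_of_all _ fun t => norm_inv_halfPlane_le (sub_pos.2 hw) le_rfl t)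

theorem differentiableAt_halfPlaneCauchy {c : ℝ} {E : Set ℝ} (hE : volume E ≠ ⊤) {w : ℂ}
    (hw : w.re < c) : DifferentiableAt ℂ (halfPlaneCauchy c E) w := by
  set x := c - w.re
  have hx0 : 0 < x := sub_pos.2 hw
  have hnear : ∀ v ∈ ball w (x / 2), x / 2 ≤ c - v.re := fun v hv => by
    have h1 := Complex.re_le_norm (v - w)
    rw [mem_ball, dist_eq_norm] at hv
    rw [Complex.sub_re] at h1
    linarith
  refine (hasDerivAt_integral_of_dominated_loc_of_deriv_le (μ := volume.restrict E)
    (F := fun v t => ((c : ℂ) - v + t * Complex.I)⁻¹)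
    (F' := fun v t => (((c : ℂ) - v + t * Complex.I)⁻¹) ^ 2)
    (bound := fun _ => ((x / 2)⁻¹) ^ 2) (ball_mem_nhds w (half_pos hx0)) ?_
    (integrableOn_inv_halfPlane hE hw) ?_ ?_ ?_ ?_).2.differentiableAt
  · filter_upwards [ball_mem_nhds w (half_pos hx0)] with v hv
    have := hnear v hv
    exact (continuous_inv_halfPlane (by linarith)).aestronglyMeasurable
  · exact ((continuous_inv_halfPlane hw).pow 2).aestronglyMeasurable
  · refine ae_of_all _ fun t v hv => ?_
    rw [norm_pow]
    gcongr
    exact norm_inv_halfPlane_le (half_pos hx0) (hnear v hv) t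
  · exact integrableOn_const hE
  · refine ae_of_all _ fun t v hv => ?_
    have hv' := hnear v hv
    have h0 := halfPlane_ne_zero (c := c) (w := v) (by linarith) t
    have h1 : HasDerivAt (fun v : ℂ => (c : ℂ) - v + t * Complex.I) (-1) v :=
      ((hasDerivAt_id v).const_sub _).add_const _
    refine (h1.fun_inv h0).congr_deriv ?_
    rw [neg_neg, one_div, inv_pow]

theorem re_inv_halfPlane {c : ℝ} (w : ℂ) (t : ℝ) : (((c : ℂ) - w + t * Complex.I)⁻¹).re
    = (c - w.re) / ((c - w.re) ^ 2 + (t - w.im) ^ 2) := by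
  rw [Complex.inv_re, Complex.normSq_apply]
  simp
  ring

theorem re_halfPlaneCauchy {c : ℝ} {E : Set ℝ} (hE : volume E ≠ ⊤) {w : ℂ} (hw : w.re < c) :
    (halfPlaneCauchy c E w).re = ∫ t in E, (c - w.re) / ((c - w.re) ^ 2 + (t - w.im) ^ 2) := by
  have := Complex.reCLM.integral_comp_comm (integrableOn_inv_halfPlane hE hw)
  simp only [Complex.reCLM_apply, re_inv_halfPlane] at this
  exact this.symm

theorem re_halfPlaneCauchy_nonneg {c : ℝ} {E : Set ℝ} (hE : volume E ≠ ⊤) {w : ℂ}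
    (hw : w.re < c) : 0 ≤ (halfPlaneCauchy c E w).re := by
  rw [re_halfPlaneCauchy hE hw]
  have := sub_pos.2 hw
  exact integral_nonneg fun t => by positivity

theorem re_halfPlaneCauchy_le {c : ℝ} {E : Set ℝ} (hE : volume E ≠ ⊤) {w : ℂ}
    (hw : w.re < c) : (halfPlaneCauchy c E w).re ≤ (c - w.re)⁻¹ * volume.real E := by
  refine (Complex.re_le_norm _).trans ?_
  exact norm_setIntegral_le_of_norm_le_const hE.lt_top
    fun t _ => norm_inv_halfPlane_le (sub_pos.2 hw) le_rfl t

theorem one_le_re_halfPlaneCauchy {c : ℝ} {E : Set ℝ} (hE : volume E ≠ ⊤) {w : ℂ}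
    (hw : w.re < c) (hsub : Ioo (w.im - (c - w.re)) (w.im + (c - w.re)) ⊆ E) :
    1 ≤ (halfPlaneCauchy c E w).re := by
  have hx : 0 < c - w.re := sub_pos.2 hw
  have hint : IntegrableOn (fun t => (c - w.re) / ((c - w.re) ^ 2 + (t - w.im) ^ 2)) E := by
    have := Complex.reCLM.integrable_comp (integrableOn_inv_halfPlane hE hw)
    simp only [Complex.reCLM_apply, re_inv_halfPlane] at this
    exact this
  rw [re_halfPlaneCauchy hE hw]
  set x := c - w.re
  calc (1 : ℝ) = ∫ t in Ioo (w.im - x) (w.im + x), (2 * x)⁻¹ := by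
        rw [setIntegral_const, Real.volume_real_Ioo_of_le (by linarith), smul_eq_mul]
        field_simp
        ring
    _ ≤ ∫ t in Ioo (w.im - x) (w.im + x), x / (x ^ 2 + (t - w.im) ^ 2) := by
        refine setIntegral_mono_on (integrableOn_const (by simp)) (hint.mono_set hsub)
          measurableSet_Ioo fun t ht => ?_
        have h1 : (t - w.im) ^ 2 ≤ x ^ 2 := sq_le_sq' (by linarith [ht.1]) (by linarith [ht.2])
        rw [inv_eq_one_div, div_le_div_iff₀ (by positivity) (by positivity)]
        nlinarith
    _ ≤ ∫ t in E, x / (x ^ 2 + (t - w.im) ^ 2) :=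
        setIntegral_mono_set hint (ae_of_all _ fun t => by positivity) hsub.eventuallyLE

/-- Subharmonic functions with boundary values `φ` have a common upper bound close to `φ ζ` near a
boundary point `ζ` lying in a nontrivial connected closed subset `K` of the complement.

With `ζ' ≠ ζ` in `K` and a branch `L` of the logarithm of `(z - ζ) / (z - ζ')` in `Ω`, the
subdomain where `‖z - ζ‖ < ρ * ‖z - ζ'‖` is mapped by `L` into the half-plane `Re w < log ρ`.
The part of its boundary inside `Ω` goes to a subset `E` of the boundary line, of length at most
`2π` however wild the domain is. The harmonic measure of `E`, composed with `L`, is the barrier: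
it is bounded below near that part and tends to `0` at `ζ`, where `Re L` tends to `-∞`. -/
theorem eventually_forall_locallySubmean_le {Ω K : Set ℂ} (hΩ : IsOpen Ω) (hconn : IsConnected Ω)
    (hb : Bornology.IsBounded Ω) (hK : IsPreconnected K) (hKc : IsClosed K)
    (hdisj : Disjoint Ω K) {ζ ζ' : ℂ} (hζ : ζ ∈ K) (hζ' : ζ' ∈ K) (hne : ζ ≠ ζ')
    (hfr : ζ ∈ frontier Ω) {φ : ℂ → ℝ} (hφ : ContinuousOn φ (closure Ω)) {ε : ℝ} (hε : 0 < ε) :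
    ∀ᶠ z in 𝓝[Ω] ζ, ∀ s : ℂ → ℝ, ContinuousOn s (closure Ω) → LocallySubmean Ω s →
      (∀ p ∈ frontier Ω, s p = φ p) → s z ≤ φ ζ + ε := by
  obtain ⟨L, hL, he⟩ := exists_log_div hΩ hconn hK hKc hdisj hζ hζ'
  have hζΩ : ζ' ∉ Ω := fun h => disjoint_left.1 hdisj h hζ'
  obtain ⟨M, hM⟩ := hb.isCompact_closure.exists_bound_of_continuousOn hφ
  simp only [Real.norm_eq_abs] at hM
  have hM0 : 0 ≤ M := (abs_nonneg _).trans (hM ζ hfr.1)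
  obtain ⟨η, hη, hφη⟩ := Metric.continuousOn_iff.1 hφ ζ hfr.1 (ε / 2) (by positivity)
  obtain ⟨D', hD'⟩ := hb.isCompact_closure.exists_bound_of_continuousOn
    (f := fun z => z - ζ') (by fun_prop)
  set D := max D' 1
  have hD0 : 0 < D := lt_max_of_lt_right one_pos
  have hD : ∀ z ∈ closure Ω, ‖z - ζ'‖ ≤ D := fun z hz => (hD' z hz).trans (le_max_left _ _)
  -- this makes the points of `Ω` with `‖z - ζ‖ ≤ ρ * ‖z - ζ'‖` closer to `ζ` than `η`
  set ρ := η / (2 * D) with hρdef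
  have hρ : 0 < ρ := by positivity
  have hnear : ∀ z ∈ closure Ω, ‖z - ζ‖ ≤ ρ * ‖z - ζ'‖ → φ z < φ ζ + ε / 2 := by
    intro z hz h
    have h1 : ρ * ‖z - ζ'‖ ≤ ρ * D := by gcongr; exact hD z hz
    have h2 : ρ * D = η / 2 := by rw [hρdef]; field_simp
    have h3 := hφη z hz (by rw [dist_eq_norm]; linarith)
    rw [Real.dist_eq] at h3
    linarith [(abs_lt.1 h3).2]
  have hre : ∀ z ∈ Ω, Real.exp (L z).re = ‖z - ζ‖ / ‖z - ζ'‖ := fun z hz => by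
    rw [← Complex.norm_exp, he z hz, norm_div]
  have hpos' : ∀ z ∈ Ω, 0 < ‖z - ζ'‖ := fun z hz =>
    norm_pos_iff.2 (sub_ne_zero.2 fun h => hζΩ (h ▸ hz))
  set c := Real.log ρ with hc
  have hexpc : Real.exp c = ρ := Real.exp_log hρ
  set E : Set ℝ := {t : ℝ | (c + t * Complex.I : ℂ) ∈ L '' Ω}
  obtain ⟨hEo, hEv⟩ := volume_vertical_slice_le hΩ hne hζΩ hL he c
  have hEfin : volume E ≠ ⊤ := (hEv.trans_lt ENNReal.ofReal_lt_top).ne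
  have hEr : volume.real E ≤ 2 * π :=
    ENNReal.toReal_le_of_le_ofReal Real.two_pi_pos.le hEv
  set W : Set ℂ := {z ∈ Ω | ‖z - ζ‖ < ρ * ‖z - ζ'‖}
  have hWo : IsOpen W :=
    hΩ.inter (isOpen_lt (f := fun z => ‖z - ζ‖) (g := fun z => ρ * ‖z - ζ'‖)
      (by fun_prop) (by fun_prop))
  have hWΩ : W ⊆ Ω := fun z hz => hz.1
  have hWre : ∀ z ∈ W, (L z).re < c := fun z hz => by
    rw [← Real.exp_lt_exp, hre z hz.1, hexpc, div_lt_iff₀ (hpos' z hz.1)]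
    exact hz.2
  set h : ℂ → ℝ := fun z => (halfPlaneCauchy c E (L z)).re
  have hanal : AnalyticOnNhd ℂ (fun z => halfPlaneCauchy c E (L z)) W := by
    refine DifferentiableOn.analyticOnNhd (fun z hz => ?_) hWo
    have h1 := differentiableAt_halfPlaneCauchy hEfin (hWre z hz)
    exact (DifferentiableAt.comp z h1
      (hL.differentiableAt (hΩ.mem_nhds hz.1))).differentiableWithinAt
  have hharm : HarmonicOnNhd h W := fun z hz => (hanal z hz).harmonicAt_re
  have hcomp : ∀ s : ℂ → ℝ, ContinuousOn s (closure Ω) → LocallySubmean Ω s →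
      (∀ p ∈ frontier Ω, s p = φ p) → ∀ z ∈ W, s z ≤ φ ζ + ε / 2 + 2 * M * h z := by
    intro s hs hsub hbd z hz
    have hsM : ∀ z ∈ Ω, s z ≤ M := hsub.le_of_le_on_frontier hΩ hb hs fun p hp => by
      rw [hbd p hp]
      exact (abs_le.1 (hM p hp.1)).2
    have hg : HarmonicOnNhd ((fun _ => φ ζ + ε / 2) + (2 * M) • h) W :=
      (harmonicOnNhd_const _).add hharm.const_smul
    have hsW : ContinuousOn s W := hs.mono (hWΩ.trans subset_closure)
    have key := ((hsub.mono hWΩ).sub_harmonic hWo hsW hg).nonpos hWo (hb.subset hWΩ)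
      (hsW.sub hg.continuousOn) (fun p hp δ hδ => ?_) z hz
    · simp only [Pi.sub_apply, Pi.add_apply, Pi.smul_apply, smul_eq_mul] at key
      linarith
    have hpΩ : p ∈ closure Ω := closure_mono hWΩ hp.1
    have hpW : p ∉ W := by rw [hWo.frontier_eq] at hp; exact hp.2
    have hple : ‖p - ζ‖ ≤ ρ * ‖p - ζ'‖ := by
      have hcl : IsClosed {z : ℂ | ‖z - ζ‖ ≤ ρ * ‖z - ζ'‖} :=
        isClosed_le (by fun_prop) (by fun_prop)
      exact closure_minimal (fun z (hz : z ∈ W) => hz.2.le) hcl hp.1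
    simp only [Pi.sub_apply, Pi.add_apply, Pi.smul_apply, smul_eq_mul]
    by_cases hpin : p ∈ Ω
    · have hpeq : (L p).re = c := by
        have h1 : ‖p - ζ‖ = ρ * ‖p - ζ'‖ := le_antisymm hple (not_lt.1 fun h => hpW ⟨hpin, h⟩)
        rw [← Real.exp_eq_exp, hre p hpin, hexpc, h1, mul_div_cancel_right₀ _ (hpos' p hpin).ne']
      have hpE : (L p).im ∈ E := ⟨p, hpin, by rw [← hpeq, Complex.re_add_im]⟩
      obtain ⟨κ, hκ, hκE⟩ := Metric.isOpen_iff.1 hEo _ hpE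
      have hLc : ContinuousAt L p := (hL.differentiableAt (hΩ.mem_nhds hpin)).continuousAt
      filter_upwards [self_mem_nhdsWithin,
        nhdsWithin_le_nhds (hLc.eventually (ball_mem_nhds (L p) (half_pos hκ)))] with v hv hLv
      have h1 : 1 ≤ h v := by
        refine one_le_re_halfPlaneCauchy hEfin (hWre v hv) fun t ht => hκE ?_
        rw [dist_eq_norm] at hLv
        have h2 := (abs_le.1 ((Complex.abs_re_le_norm (L v - L p)).trans hLv.le)).1
        have h3 := abs_le.1 ((Complex.abs_im_le_norm (L v - L p)).trans hLv.le)
        rw [Complex.sub_re, hpeq] at h2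
        rw [Complex.sub_im] at h3
        rw [mem_ball, Real.dist_eq, abs_lt]
        constructor <;> linarith [ht.1, ht.2, h3.1, h3.2]
      have h2 := (abs_le.1 (hM ζ hfr.1)).1
      nlinarith [hsM v hv.1]
    · have hpf : p ∈ frontier Ω := ⟨hpΩ, by rwa [hΩ.interior_eq]⟩
      have h1 : Tendsto s (𝓝[W] p) (𝓝 (s p)) :=
        ((hs p hpΩ).mono (hWΩ.trans subset_closure)).tendsto
      rw [hbd p hpf] at h1
      filter_upwards [self_mem_nhdsWithin, h1.eventually (gt_mem_nhds (hnear p hpΩ hple))]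
        with v hv hsv
      have h2 : 0 ≤ h v := re_halfPlaneCauchy_nonneg hEfin (hWre v hv)
      nlinarith [mul_nonneg hM0 h2]
  -- the barrier is small where `Re L < c - T`
  set T := 8 * M * π / ε + 1 with hT
  have hT0 : 0 < T := by positivity
  have hlim : Tendsto (fun z => ‖z - ζ‖ / ‖z - ζ'‖) (𝓝[Ω] ζ) (𝓝 0) := by
    have hc : ContinuousAt (fun z => ‖z - ζ‖ / ‖z - ζ'‖) ζ :=
      ContinuousAt.div (by fun_prop) (by fun_prop) (norm_ne_zero_iff.2 (sub_ne_zero.2 hne))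
    have h2 := hc.tendsto
    simp only [sub_self, norm_zero, zero_div] at h2
    exact h2.mono_left nhdsWithin_le_nhds
  filter_upwards [self_mem_nhdsWithin, hlim.eventually (gt_mem_nhds (Real.exp_pos (c - T)))]
    with z hz hzT s hs hsub hbd
  have hreT : (L z).re < c - T := by rwa [← Real.exp_lt_exp, hre z hz]
  have hrec : (L z).re < c := by linarith
  have hzW : z ∈ W := by
    refine ⟨hz, ?_⟩
    rw [← Real.exp_lt_exp, hre z hz, hexpc, div_lt_iff₀ (hpos' z hz)] at hrec
    exact hrec
  have hhz : h z ≤ T⁻¹ * (2 * π) := by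
    refine (re_halfPlaneCauchy_le hEfin hrec).trans ?_
    gcongr
    linarith
  have h3 : 2 * M * h z ≤ ε / 2 := by
    calc 2 * M * h z ≤ 2 * M * (T⁻¹ * (2 * π)) := by gcongr
      _ = (4 * M * π) / T := by field_simp; ring
      _ ≤ ε / 2 := by
        rw [div_le_iff₀ hT0, hT]
        have : ε / 2 * (8 * M * π / ε + 1) = 4 * M * π + ε / 2 := by field_simp; ring
        linarith
  linarith [hcomp s hs hsub hbd z hzW]

/-! ### The Dirichlet problem -/

theorem IsClosed.isClosed_connectedComponentIn {X : Type*} [TopologicalSpace X] {F : Set X}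
    (hF : IsClosed F) (x : X) : IsClosed (connectedComponentIn F x) := by
  by_cases hx : x ∈ F
  · refine isClosed_of_closure_subset ?_
    refine isPreconnected_connectedComponentIn.closure.subset_connectedComponentIn
      (subset_closure (mem_connectedComponentIn hx)) ?_
    exact closure_minimal (connectedComponentIn_subset F x) hF
  · rw [connectedComponentIn_eq_empty hx]
    exact isClosed_empty

/-- The Dirichlet problem is solvable for boundary values that extend to a continuous function,
subharmonic in `Ω`. This function bounds the solution from below, so only the upper estimate at the
boundary needs a barrier. -/
theorem exists_isDirichletSolution {Ω : Set ℂ} (hΩ : IsOpen Ω) (hconn : IsConnected Ω)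
    (hb : Bornology.IsBounded Ω)
    (hnondeg : ∀ z ∈ Ωᶜ, (connectedComponentIn Ωᶜ z).Nontrivial) {φ : ℂ → ℝ}
    (hφ : ContinuousOn φ (closure Ω)) (hsub : LocallySubmean Ω φ) :
    ∃ u, IsDirichletSolution Ω φ u := by
  obtain ⟨u, s, hu, hle, hout, hs, hlim⟩ := exists_harmonic_limit hΩ hconn.nonempty hb hφ hsub
  have hfrΩ : ∀ ζ ∈ frontier Ω, ζ ∉ Ω := fun ζ hζ => by
    rw [hΩ.frontier_eq] at hζ
    exact hζ.2
  refine ⟨u, fun ζ hζ => ?_, hu, fun ζ hζ => hout ζ (hfrΩ ζ hζ)⟩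
  by_cases hζΩ : ζ ∈ Ω
  · exact (hu ζ hζΩ).1.continuousAt.continuousWithinAt
  have hfr : ζ ∈ frontier Ω := ⟨hζ, by rwa [hΩ.interior_eq]⟩
  have huζ : u ζ = φ ζ := hout ζ hζΩ
  have hmem : ζ ∈ connectedComponentIn Ωᶜ ζ := mem_connectedComponentIn hζΩ
  obtain ⟨ζ', hζ', hne⟩ := (hnondeg ζ hζΩ).exists_ne ζ
  rw [ContinuousWithinAt, huζ, tendsto_order]
  refine ⟨fun a ha => ?_, fun a ha => ?_⟩
  · filter_upwards [(hφ ζ hζ).eventually (lt_mem_nhds ha)] with z hz using hz.trans_le (hle z)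
  · have hbar := eventually_forall_locallySubmean_le hΩ hconn hb
      isPreconnected_connectedComponentIn (hΩ.isClosed_compl.isClosed_connectedComponentIn ζ)
      (disjoint_compl_right.mono_right (connectedComponentIn_subset _ _)) hmem hζ' hne.symm hfr hφ
      (half_pos (sub_pos.2 ha))
    rw [eventually_nhdsWithin_iff] at hbar
    filter_upwards [(hφ ζ hζ).eventually (gt_mem_nhds ha), nhdsWithin_le_nhds hbar] with z hz hbz
    by_cases hzΩ : z ∈ Ω
    · have h1 : u z ≤ φ ζ + (a - φ ζ) / 2 := le_of_tendsto (hlim z) <|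
        Eventually.of_forall fun n => hbz hzΩ (s n) (hs n).1 (hs n).2.1
          fun p hp => (hs n).2.2 p (hfrΩ p hp)
      linarith
    · rwa [hout z hzΩ]

theorem LocallySubmean.le_isDirichletSolution {Ω : Set ℂ} (hΩ : IsOpen Ω)
    (hb : Bornology.IsBounded Ω) {s φ u : ℂ → ℝ} (hs : LocallySubmean Ω s)
    (hsc : ContinuousOn s (closure Ω)) (hsφ : ∀ p ∈ frontier Ω, s p ≤ φ p)
    (hu : IsDirichletSolution Ω φ u) : ∀ z ∈ Ω, s z ≤ u z := by
  intro z hz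
  rw [← sub_nonpos]
  exact (hs.sub_harmonic hΩ (hsc.mono subset_closure) hu.harmonic).le_of_le_on_frontier hΩ hb
    (hsc.sub hu.continuousOn) (fun p hp => by
      rw [Pi.sub_apply, hu.boundary p hp, sub_nonpos]
      exact hsφ p hp) z hz

theorem IsDirichletSolution.eqOn {Ω : Set ℂ} (hΩ : IsOpen Ω) (hb : Bornology.IsBounded Ω)
    {φ u v : ℂ → ℝ} (hu : IsDirichletSolution Ω φ u) (hv : IsDirichletSolution Ω φ v) :
    EqOn v u (closure Ω) := by
  intro z hz
  by_cases hzΩ : z ∈ Ω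
  · exact le_antisymm
      ((hv.harmonic.locallySubmean hΩ).le_isDirichletSolution hΩ hb hv.continuousOn
        (fun p hp => (hv.boundary p hp).le) hu z hzΩ)
      ((hu.harmonic.locallySubmean hΩ).le_isDirichletSolution hΩ hb hu.continuousOn
        (fun p hp => (hu.boundary p hp).le) hv z hzΩ)
  · have hfr : z ∈ frontier Ω := ⟨hz, by rwa [hΩ.interior_eq]⟩
    rw [hu.boundary z hfr, hv.boundary z hfr]

/-- `‖w‖ ^ 2` exceeds a real affine function of `w`, its tangent at `z`, by `‖w - z‖ ^ 2`. -/
theorem locallySubmean_norm_sq (Ω : Set ℂ) : LocallySubmean Ω fun z => ‖z‖ ^ 2 := by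
  intro z _
  filter_upwards [self_mem_nhdsWithin] with r (hr : 0 < r)
  set h : ℂ → ℝ := fun w => (2 * conj z * w - conj z * z).re with hh
  have hharm : HarmonicOnNhd h (closedBall z |r|) := fun w _ =>
    AnalyticAt.harmonicAt_re (f := fun w => 2 * conj z * w - conj z * z) (by fun_prop)
  have havg := hharm.circleAverage_eq
  have hkey : ∀ w, ‖w‖ ^ 2 - h w = ‖w - z‖ ^ 2 := fun w => by
    simp only [hh, ← Complex.normSq_eq_norm_sq, Complex.normSq_apply, Complex.sub_re,
      Complex.sub_im, Complex.mul_re, Complex.mul_im, Complex.conj_re, Complex.conj_im,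
      Complex.re_ofNat, Complex.im_ofNat]
    ring
  have hz : ‖z‖ ^ 2 = h z := by
    have := hkey z
    rw [sub_self, norm_zero] at this
    linarith
  have hcont : Continuous h := by fun_prop
  rw [hz, ← havg]
  refine circleAverage_mono (hcont.continuousOn.circleIntegrable hr.le)
    (Continuous.continuousOn (by fun_prop) |>.circleIntegrable hr.le) fun w _ => ?_
  have := hkey w
  nlinarith [sq_nonneg ‖w - z‖]

/-! ### The complex derivative of a real harmonic function -/

/-- The Wirtinger derivative `∂u = (∂u/∂x - i ∂u/∂y) / 2` of a real function. -/
noncomputable def wirtingerDeriv (u : ℂ → ℝ) (z : ℂ) : ℂ :=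
  (fderiv ℝ u z 1 - Complex.I * fderiv ℝ u z Complex.I) / 2

theorem hasFDerivAt_two_mul_re {F : ℂ → ℂ} {F' z : ℂ} (hF : HasDerivAt F F' z) :
    HasFDerivAt (fun w => 2 * (F w).re)
      ((2 : ℝ) • Complex.reCLM.comp (ContinuousLinearMap.mul ℝ ℂ F')) z := by
  have h1 : HasFDerivAt F (ContinuousLinearMap.mul ℝ ℂ F') z := by
    refine (hF.hasFDerivAt.restrictScalars ℝ).congr_fderiv ?_
    ext
    simp [mul_comm]
  exact (Complex.reCLM.hasFDerivAt.comp z h1).const_mul 2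

theorem wirtingerDeriv_eq_of_eventuallyEq_two_mul_re {F : ℂ → ℂ} {F' z : ℂ} {u : ℂ → ℝ}
    (hF : HasDerivAt F F' z) (hu : u =ᶠ[𝓝 z] fun w => 2 * (F w).re) :
    wirtingerDeriv u z = F' := by
  rw [wirtingerDeriv, ((hasFDerivAt_two_mul_re hF).congr_of_eventuallyEq hu).fderiv]
  apply Complex.ext <;> simp

theorem isTwiceRePrimitive_iff {Ω : Set ℂ} (hΩ : IsOpen Ω) {f : ℂ → ℂ} {u : ℂ → ℝ} :
    IsTwiceRePrimitive Ω f u ↔ HarmonicOnNhd u Ω ∧ EqOn f (wirtingerDeriv u) Ω := by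
  have hre : ∀ (a : ℝ) (F : ℂ), (a : ℂ) = F + conj F ↔ a = 2 * F.re := fun a F => by
    rw [Complex.add_conj]
    norm_cast
  constructor
  · intro h
    have key : ∀ z ∈ Ω, HarmonicAt u z ∧ f z = wirtingerDeriv u z := by
      intro z hz
      obtain ⟨r, hr, -, F, hF⟩ := h z hz
      have heq : u =ᶠ[𝓝 z] fun w => 2 * (F w).re := by
        filter_upwards [ball_mem_nhds z hr] with w hw using (hre _ _).1 (hF w hw).2
      have hd : DifferentiableOn ℂ F (ball z r) := fun w hw =>
        (hF w hw).1.differentiableAt.differentiableWithinAt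
      have ha := (hd.analyticOnNhd isOpen_ball) z (mem_ball_self hr)
      refine ⟨(harmonicAt_congr_nhds heq).2 ?_,
        (wirtingerDeriv_eq_of_eventuallyEq_two_mul_re (hF z (mem_ball_self hr)).1 heq).symm⟩
      exact ha.harmonicAt_re.const_smul (c := (2 : ℝ))
    exact ⟨fun z hz => (key z hz).1, fun z hz => (key z hz).2⟩
  · rintro ⟨hu, hf⟩ z hz
    obtain ⟨r, hr, hrΩ⟩ := Metric.isOpen_iff.1 hΩ z hz
    obtain ⟨F, hF, hFu⟩ := HarmonicOnNhd.exists_analyticOnNhd_ball_re_eq (hu.mono hrΩ)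
    refine ⟨r, hr, hrΩ, fun w => F w / 2, fun w hw => ?_⟩
    have hd : HasDerivAt (fun w => F w / 2) (deriv F w / 2) w :=
      (hF w hw).differentiableAt.hasDerivAt.div_const 2
    have h2 : ∀ w ∈ ball z r, u w = 2 * (F w / 2).re := fun w hw => by
      have := hFu hw
      simp only at this
      rw [← this]
      simp
      ring
    refine ⟨?_, (hre _ _).2 (h2 w hw)⟩
    rw [hf (hrΩ hw), wirtingerDeriv_eq_of_eventuallyEq_two_mul_re hd ?_]
    · exact hd
    · filter_upwards [isOpen_ball.mem_nhds hw] with v hv using h2 v hv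

theorem wirtingerDeriv_congr {u v : ℂ → ℝ} {Ω : Set ℂ} (hΩ : IsOpen Ω) (h : EqOn u v Ω) :
    EqOn (wirtingerDeriv u) (wirtingerDeriv v) Ω := fun z hz => by
  have : u =ᶠ[𝓝 z] v := by filter_upwards [hΩ.mem_nhds hz] with w hw using h hw
  rw [wirtingerDeriv, wirtingerDeriv, this.fderiv_eq]

theorem InnerProductSpace.HarmonicOnNhd.differentiableOn_wirtingerDeriv {Ω : Set ℂ}
    {u : ℂ → ℝ} (hu : HarmonicOnNhd u Ω) : DifferentiableOn ℂ (wirtingerDeriv u) Ω := fun z hz =>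
  ((HarmonicAt.differentiableAt_complex_partial (hu z hz)).div_const 2).differentiableWithinAt

theorem HarmonicAt.hasFDerivAt_wirtingerDeriv {u : ℂ → ℝ} {z : ℂ} (hu : HarmonicAt u z) :
    HasFDerivAt u
      ((2 : ℝ) • Complex.reCLM.comp (ContinuousLinearMap.mul ℝ ℂ (wirtingerDeriv u z))) z := by
  refine (hu.1.differentiableAt two_ne_zero).hasFDerivAt.congr_fderiv ?_
  ext w
  have hw : w = w.re • (1 : ℂ) + w.im • Complex.I := by simp
  have h2 : fderiv ℝ u z w = w.re * fderiv ℝ u z 1 + w.im * fderiv ℝ u z Complex.I := by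
    conv_lhs => rw [hw]
    rw [map_add, map_smul, map_smul, smul_eq_mul, smul_eq_mul]
  rw [h2]
  simp [wirtingerDeriv]
  ring

/-! ### Integration by parts against a truncated Dirichlet solution -/

theorem ContinuousOn.integrableOn_of_eq_zero_off_isCompact {Ω K : Set ℂ} (hΩ : IsOpen Ω)
    (hK : IsCompact K) (hKΩ : K ⊆ Ω) {E : Type*} [NormedAddCommGroup E] {g : ℂ → E}
    (hg : ContinuousOn g Ω) (h0 : ∀ z ∈ Ω, z ∉ K → g z = 0) : IntegrableOn g Ω :=
  ((hg.mono hKΩ).integrableOn_compact hK).of_forall_sdiff_eq_zero hΩ.measurableSet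
    fun z hz => h0 z hz.1 hz.2

/-- The `∂`-derivative of a `C¹` function with compact support in `Ω` has integral zero. -/
theorem integral_wirtinger_eq_zero {Ω K : Set ℂ} (hΩ : IsOpen Ω) (hK : IsCompact K) (hKΩ : K ⊆ Ω)
    {Ψ : ℂ → ℂ} {A : ℂ → ℂ →L[ℝ] ℂ} (hΨ : ∀ z ∈ Ω, HasFDerivAt Ψ (A z) z)
    (hA : ∀ w, ContinuousOn (fun z => A z w) Ω) (h0 : ∀ z ∈ Ω, z ∉ K → Ψ z = 0) :
    ∫ z in Ω, (A z 1 - Complex.I * A z Complex.I) = 0 := by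
  have hout : ∀ z ∉ K, Ω.indicator Ψ =ᶠ[𝓝 z] fun _ => 0 := fun z hz => by
    filter_upwards [hK.isClosed.isOpen_compl.mem_nhds hz] with w hw
    by_cases hwΩ : w ∈ Ω
    · rw [indicator_of_mem hwΩ, h0 w hwΩ hw]
    · rw [indicator_of_notMem hwΩ]
  have hin : ∀ z ∈ Ω, HasFDerivAt (Ω.indicator Ψ) (A z) z := fun z hz => by
    refine (hΨ z hz).congr_of_eventuallyEq ?_
    filter_upwards [hΩ.mem_nhds hz] with w hw using indicator_of_mem hw _
  have hdiff : Differentiable ℝ (Ω.indicator Ψ) := fun z => by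
    by_cases hz : z ∈ Ω
    · exact (hin z hz).differentiableAt
    · exact (differentiableAt_const (0 : ℂ)).congr_of_eventuallyEq (hout z fun h => hz (hKΩ h))
  have hfd0 : ∀ z ∉ K, fderiv ℝ (Ω.indicator Ψ) z = 0 := fun z hz => by
    rw [(hout z hz).fderiv_eq]
    simp
  have hA0 : ∀ z ∈ Ω, z ∉ K → A z = 0 := fun z hz hzK => by
    rw [← (hin z hz).fderiv, hfd0 z hzK]
  have hAint : ∀ w, IntegrableOn (fun z => A z w) Ω := fun w =>
    (hA w).integrableOn_of_eq_zero_off_isCompact hΩ hK hKΩ fun z hz hzK => by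
      rw [hA0 z hz hzK, zero_apply]
  have hfd : ∀ w, (fun z => fderiv ℝ (Ω.indicator Ψ) z w) = Ω.indicator fun z => A z w := by
    intro w
    ext z
    by_cases hz : z ∈ Ω
    · rw [indicator_of_mem hz, (hin z hz).fderiv]
    · rw [indicator_of_notMem hz, hfd0 z fun h => hz (hKΩ h), zero_apply]
  have hΨint : Integrable (Ω.indicator Ψ) := by
    refine hdiff.continuous.integrable_of_hasCompactSupport ?_
    exact HasCompactSupport.intro hK fun z hz => (hout z hz).eq_of_nhds
  have hzero : ∀ w, ∫ z in Ω, A z w = 0 := fun w => by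
    rw [← integral_indicator hΩ.measurableSet, ← hfd w]
    have hi : Integrable fun z => fderiv ℝ (Ω.indicator Ψ) z w := by
      rw [hfd w, integrable_indicator_iff hΩ.measurableSet]
      exact hAint w
    have := integral_mul_fderiv_eq_neg_fderiv_mul_of_integrable (μ := (volume : Measure ℂ))
      (f := fun _ => (1 : ℂ)) (g := Ω.indicator Ψ) (v := w) (by simp) (by simpa using hi)
      (by simpa using hΨint) (fun _ _ => by fun_prop) (fun x _ => hdiff x)
    simpa using this
  rw [integral_sub (hAint _) ((hAint _).const_mul _), integral_const_mul, hzero, hzero]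
  simp

/-- A `C¹` function vanishing on `(-∞, ε]`, which tends to the positive part as `ε → 0`, together
with its derivative. -/
noncomputable def cutoff (ε t : ℝ) : ℝ := (max ε t - ε) ^ 2 / max ε t

theorem cutoff_of_le {ε t : ℝ} (h : t ≤ ε) : cutoff ε t = 0 := by
  simp [cutoff, max_eq_left h]

/-- The derivative of `cutoff ε`. -/
noncomputable def cutoffDeriv (ε t : ℝ) : ℝ := 1 - (ε / max ε t) ^ 2

theorem cutoffDeriv_of_le {ε t : ℝ} (hε : 0 < ε) (h : t ≤ ε) : cutoffDeriv ε t = 0 := by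
  simp [cutoffDeriv, max_eq_left h, hε.ne']

theorem cutoffDeriv_mem_Icc {ε : ℝ} (hε : 0 < ε) (t : ℝ) : cutoffDeriv ε t ∈ Icc (0 : ℝ) 1 := by
  have hm : 0 < max ε t := lt_max_of_lt_left hε
  have h1 : ε / max ε t ≤ 1 := (div_le_one hm).2 (le_max_left _ _)
  have h0 : 0 ≤ ε / max ε t := by positivity
  constructor <;> rw [cutoffDeriv] <;> nlinarith

theorem cutoff_le {ε t : ℝ} (hε : 0 < ε) (ht : 0 ≤ t) : cutoff ε t ≤ t := by
  rcases le_total t ε with h | h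
  · rwa [cutoff_of_le h]
  · rw [cutoff, max_eq_right h, div_le_iff₀ (by linarith)]
    nlinarith

theorem continuous_cutoff {ε : ℝ} (hε : 0 < ε) : Continuous (cutoff ε) := by
  unfold cutoff
  exact Continuous.div (by fun_prop) (by fun_prop) fun t => (lt_max_of_lt_left hε).ne'

theorem continuous_cutoffDeriv {ε : ℝ} (hε : 0 < ε) : Continuous (cutoffDeriv ε) := by
  unfold cutoffDeriv
  exact continuous_const.sub ((Continuous.div continuous_const (by fun_prop)
    fun t => (lt_max_of_lt_left hε).ne').pow 2)

theorem hasDerivAt_cutoff {ε : ℝ} (hε : 0 < ε) (t : ℝ) :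
    HasDerivAt (cutoff ε) (cutoffDeriv ε t) t := by
  have hpoly : ∀ t, 0 < t → HasDerivAt (fun t => (t - ε) ^ 2 / t) (1 - (ε / t) ^ 2) t := by
    intro t ht
    have h := (((hasDerivAt_id t).sub_const ε).pow 2).fun_div (hasDerivAt_id t) ht.ne'
    refine h.congr_deriv ?_
    simp
    field_simp
    ring
  have hright : ∀ s, ε ≤ s → cutoff ε s = (s - ε) ^ 2 / s := fun s hs => by
    rw [cutoff, max_eq_right hs]
  rcases lt_trichotomy t ε with h | rfl | h
  · rw [cutoffDeriv_of_le hε h.le]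
    refine (hasDerivAt_const t (0 : ℝ)).congr_of_eventuallyEq ?_
    filter_upwards [gt_mem_nhds h] with s hs using cutoff_of_le hs.le
  · rw [cutoffDeriv_of_le hε le_rfl, ← hasDerivWithinAt_univ, ← Iic_union_Ici (a := t)]
    refine HasDerivWithinAt.union ?_ ?_
    · exact (hasDerivWithinAt_const t _ (0 : ℝ)).congr (fun s hs => cutoff_of_le hs)
        (cutoff_of_le le_rfl)
    · have h1 := (hpoly t hε).hasDerivWithinAt (s := Ici t)
      rw [div_self hε.ne'] at h1
      norm_num at h1
      exact h1.congr (fun s hs => hright s hs) (hright t le_rfl)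
  · rw [cutoffDeriv, max_eq_right h.le]
    refine (hpoly t (hε.trans h)).congr_of_eventuallyEq ?_
    filter_upwards [lt_mem_nhds h] with s hs using hright s hs.le

theorem tendsto_cutoffDeriv {t : ℝ} (ht : 0 < t) :
    Tendsto (fun n : ℕ => cutoffDeriv (1 / ((n : ℝ) + 1)) t) atTop (𝓝 1) := by
  have hlim := tendsto_one_div_add_atTop_nhds_zero_nat (𝕜 := ℝ)
  have h1 : Tendsto (fun n : ℕ => 1 - (1 / ((n : ℝ) + 1) / t) ^ 2) atTop (𝓝 1) := by
    have := ((hlim.div_const t).pow 2).const_sub 1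
    simpa using this
  refine h1.congr' ?_
  filter_upwards [hlim.eventually (gt_mem_nhds ht)] with n hn
  rw [cutoffDeriv, max_eq_right hn.le]

/-- For `q` vanishing on the boundary of `Ω`, with `∂q = -g₀`, and `g` holomorphic: the function
`cutoff ε (q z) * (c * z + conj (g z))` has compact support in `Ω`, so its `∂`-derivative has
integral zero. Here `∂(conj g) = 0`. -/
theorem integral_cutoffDeriv_mul {Ω : Set ℂ} (hΩ : IsOpen Ω) (hb : Bornology.IsBounded Ω)
    {q : ℂ → ℝ} {g₀ : ℂ → ℂ} (hq : ContinuousOn q (closure Ω)) (hqb : ∀ p ∈ frontier Ω, q p = 0)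
    (hg₀ : ContinuousOn g₀ Ω)
    (hqd : ∀ z ∈ Ω, HasFDerivAt q
      ((-2 : ℝ) • Complex.reCLM.comp (ContinuousLinearMap.mul ℝ ℂ (g₀ z))) z)
    {g : ℂ → ℂ} (hg : DifferentiableOn ℂ g Ω) (c : ℂ) {ε : ℝ} (hε : 0 < ε) :
    IntegrableOn (fun z => (cutoffDeriv ε (q z) : ℂ) * (g₀ z * (c * z + conj (g z)))) Ω ∧
    ∫ z in Ω, (cutoffDeriv ε (q z) : ℂ) * (g₀ z * (c * z + conj (g z)))
      = c * ∫ z in Ω, (cutoff ε (q z) : ℂ) := by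
  set K : Set ℂ := closure Ω ∩ q ⁻¹' Ici ε
  have hK : IsCompact K := isCompact_of_isClosed_isBounded
    (hq.preimage_isClosed_of_isClosed isClosed_closure isClosed_Ici)
    (hb.closure.subset inter_subset_left)
  have hKΩ : K ⊆ Ω := fun z hz => by
    by_contra hzΩ
    have h1 := hqb z ⟨hz.1, by rwa [hΩ.interior_eq]⟩
    have h2 : ε ≤ q z := hz.2
    linarith
  have hoff : ∀ z ∈ Ω, z ∉ K → q z ≤ ε := fun z hz hzK =>
    le_of_not_ge fun h => hzK ⟨subset_closure hz, h⟩
  have hqΩ : ContinuousOn q Ω := hq.mono subset_closure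
  have hχ : ContinuousOn (fun z => (cutoff ε (q z) : ℂ)) Ω :=
    Complex.continuous_ofReal.comp_continuousOn ((continuous_cutoff hε).comp_continuousOn hqΩ)
  have hχ' : ContinuousOn (fun z => (cutoffDeriv ε (q z) : ℂ)) Ω :=
    Complex.continuous_ofReal.comp_continuousOn ((continuous_cutoffDeriv hε).comp_continuousOn hqΩ)
  have hgc : ContinuousOn (fun z => conj (g z)) Ω :=
    Complex.continuous_conj.comp_continuousOn hg.continuousOn
  have hG : ContinuousOn (fun z => c * z + conj (g z)) Ω := (by fun_prop : Continuous fun z : ℂ =>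
    c * z).continuousOn.add hgc
  have hdg : ContinuousOn (deriv g) Ω := (hg.deriv hΩ).continuousOn
  set G' : ℂ → ℂ →L[ℝ] ℂ := fun z => ContinuousLinearMap.mul ℝ ℂ c +
    (Complex.conjCLE : ℂ →L[ℝ] ℂ).comp (ContinuousLinearMap.mul ℝ ℂ (deriv g z)) with hG'
  have hGd : ∀ z ∈ Ω, HasFDerivAt (fun z => c * z + conj (g z)) (G' z) z := fun z hz => by
    have h1 : HasFDerivAt g (ContinuousLinearMap.mul ℝ ℂ (deriv g z)) z := by
      refine ((hg.differentiableAt (hΩ.mem_nhds hz)).hasDerivAt.hasFDerivAt.restrictScalars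
        ℝ).congr_fderiv ?_
      ext
      simp [mul_comm]
    exact (ContinuousLinearMap.mul ℝ ℂ c).hasFDerivAt.add
      ((Complex.conjCLE : ℂ →L[ℝ] ℂ).hasFDerivAt.comp z h1)
  set q' : ℂ → ℂ →L[ℝ] ℝ := fun z =>
    (-2 : ℝ) • Complex.reCLM.comp (ContinuousLinearMap.mul ℝ ℂ (g₀ z)) with hq'
  set A : ℂ → ℂ →L[ℝ] ℂ := fun z => cutoff ε (q z) • G' z +
    (cutoffDeriv ε (q z) • q' z).smulRight (c * z + conj (g z)) with hAdef
  have hΨ : ∀ z ∈ Ω, HasFDerivAt (fun z => cutoff ε (q z) • (c * z + conj (g z))) (A z) z :=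
    fun z hz => ((hasDerivAt_cutoff hε (q z)).comp_hasFDerivAt z (hqd z hz)).smul (hGd z hz)
  have hAapp : ∀ z w, A z w = (cutoff ε (q z) : ℂ) * (c * w + conj (deriv g z * w)) +
      (cutoffDeriv ε (q z) : ℂ) * (-2 * ((g₀ z * w).re : ℂ)) * (c * z + conj (g z)) := by
    intro z w
    simp [hAdef, hG', hq']
    ring
  have hA : ∀ w, ContinuousOn (fun z => A z w) Ω := fun w => by
    simp only [hAapp]
    have h1 : ContinuousOn (fun z => conj (deriv g z * w)) Ω :=
      Complex.continuous_conj.comp_continuousOn (hdg.mul continuousOn_const)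
    have h2 : ContinuousOn (fun z => ((g₀ z * w).re : ℂ)) Ω :=
      (Complex.continuous_ofReal.comp Complex.continuous_re).comp_continuousOn
        (hg₀.mul continuousOn_const)
    exact (hχ.mul (continuousOn_const.add h1)).add
      ((hχ'.mul (continuousOn_const.mul h2)).mul hG)
  have hzero := integral_wirtinger_eq_zero hΩ hK hKΩ hΨ hA fun z hz hzK => by
    rw [cutoff_of_le (hoff z hz hzK), zero_smul]
  have hform : ∀ z, A z 1 - Complex.I * A z Complex.I = (2 * c) * (cutoff ε (q z) : ℂ) -
      2 * ((cutoffDeriv ε (q z) : ℂ) * (g₀ z * (c * z + conj (g z)))) := by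
    intro z
    have hre : ((g₀ z * 1).re : ℂ) - Complex.I * ((g₀ z * Complex.I).re : ℂ) = g₀ z := by
      apply Complex.ext <;> simp
    have hII := Complex.I_mul_I
    rw [hAapp, hAapp]
    simp only [map_mul, map_one, Complex.conj_I]
    linear_combination (-2 * (cutoffDeriv ε (q z) : ℂ) * (c * z + conj (g z))) * hre
      + ((cutoff ε (q z) : ℂ) * (conj (deriv g z) - c)) * hII
  simp only [hform] at hzero
  have hi1 : IntegrableOn (fun z => (cutoff ε (q z) : ℂ)) Ω :=
    hχ.integrableOn_of_eq_zero_off_isCompact hΩ hK hKΩ fun z hz hzK => by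
      rw [cutoff_of_le (hoff z hz hzK), Complex.ofReal_zero]
  have hi2 : IntegrableOn (fun z =>
      (cutoffDeriv ε (q z) : ℂ) * (g₀ z * (c * z + conj (g z)))) Ω :=
    (hχ'.mul (hg₀.mul hG)).integrableOn_of_eq_zero_off_isCompact hΩ hK hKΩ fun z hz hzK => by
      simp [cutoffDeriv_of_le hε (hoff z hz hzK)]
  rw [integral_sub (hi1.const_mul _) (hi2.const_mul _), integral_const_mul,
    integral_const_mul] at hzero
  exact ⟨hi2, by linear_combination (-1 / 2 : ℂ) * hzero⟩

/-! ### The projection is the derivative of the Dirichlet solution -/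

theorem hasFDerivAt_norm_sq_complex (z : ℂ) : HasFDerivAt (fun w : ℂ => ‖w‖ ^ 2)
    ((2 : ℝ) • Complex.reCLM.comp (ContinuousLinearMap.mul ℝ ℂ (conj z))) z := by
  refine (hasStrictFDerivAt_norm_sq z).hasFDerivAt.congr_fderiv ?_
  ext
  simp [Complex.inner, mul_comm]
  ring

theorem memLp_conj {Ω : Set ℂ} (hΩ : IsOpen Ω) (hb : Bornology.IsBounded Ω) :
    MemLp (fun z : ℂ => conj z) 2 (volume.restrict Ω) := by
  obtain ⟨R, hR⟩ := hb.exists_norm_le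
  have : IsFiniteMeasure (volume.restrict Ω) := ⟨by simpa using hb.measure_lt_top⟩
  refine MemLp.of_bound Complex.continuous_conj.aestronglyMeasurable R ?_
  filter_upwards [ae_restrict_mem hΩ.measurableSet] with z hz
  rw [Complex.norm_conj]
  exact hR z hz

/-- With `q = u - ‖z‖ ^ 2 ≥ 0` and `g₀ = conj z - ∂u = -∂q`, the truncated integration by parts
with test function `conj g₀` bounds the Dirichlet integral `∫ ‖g₀‖ ^ 2` by `∫ q`, and the one with
test function `conj g` gives orthogonality to `g`. -/
theorem isBergmanProjection_wirtingerDeriv {Ω : Set ℂ} (hΩ : IsOpen Ω)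
    (hb : Bornology.IsBounded Ω) {u : ℂ → ℝ}
    (hu : IsDirichletSolution Ω (fun z => ‖z‖ ^ 2) u) :
    IsBergmanProjection Ω (fun z => conj z) (wirtingerDeriv u) := by
  set f := wirtingerDeriv u with hf
  set q : ℂ → ℝ := fun z => u z - ‖z‖ ^ 2
  set g₀ : ℂ → ℂ := fun z => conj z - f z with hg₀
  set ε : ℕ → ℝ := fun n => 1 / ((n : ℝ) + 1)
  have hε : ∀ n, 0 < ε n := fun n => by positivity
  have hfd : DifferentiableOn ℂ f Ω := hu.harmonic.differentiableOn_wirtingerDeriv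
  have hqc : ContinuousOn q (closure Ω) := hu.continuousOn.sub (by fun_prop)
  have hqΩ : ContinuousOn q Ω := hqc.mono subset_closure
  have hqb : ∀ p ∈ frontier Ω, q p = 0 := fun p hp => sub_eq_zero.2 (hu.boundary p hp)
  have hg₀c : ContinuousOn g₀ Ω := Complex.continuous_conj.continuousOn.sub hfd.continuousOn
  have hq0 : ∀ z ∈ Ω, 0 ≤ q z := fun z hz => sub_nonneg.2 <|
    (locallySubmean_norm_sq Ω).le_isDirichletSolution hΩ hb (by fun_prop) (fun _ _ => le_rfl) hu z hz
  have hqd : ∀ z ∈ Ω, HasFDerivAt q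
      ((-2 : ℝ) • Complex.reCLM.comp (ContinuousLinearMap.mul ℝ ℂ (g₀ z))) z := fun z hz => by
    refine ((HarmonicAt.hasFDerivAt_wirtingerDeriv (hu.harmonic z hz)).sub
      (hasFDerivAt_norm_sq_complex z)).congr_fderiv ?_
    ext w
    simp only [hg₀, hf, _root_.sub_apply, _root_.smul_apply,
      ContinuousLinearMap.comp_apply, ContinuousLinearMap.mul_apply', Complex.reCLM_apply,
      smul_eq_mul, sub_mul, Complex.sub_re]
    ring
  -- where `q` vanishes it is minimal, so `g₀` vanishes too
  have hg₀0 : ∀ z ∈ Ω, q z = 0 → g₀ z = 0 := fun z hz hqz => by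
    have hmin : IsLocalMin q z := by
      filter_upwards [hΩ.mem_nhds hz] with w hw
      rw [hqz]
      exact hq0 w hw
    have h0 := hmin.hasFDerivAt_eq_zero (hqd z hz)
    have h1 := DFunLike.congr_fun h0 (conj (g₀ z))
    simp only [_root_.smul_apply, ContinuousLinearMap.comp_apply,
      ContinuousLinearMap.mul_apply', Complex.reCLM_apply, Complex.mul_conj, Complex.ofReal_re,
      smul_eq_mul, zero_apply] at h1
    exact Complex.normSq_eq_zero.1 (by linarith)
  have hlim : ∀ z ∈ Ω, ∀ a : ℝ, (g₀ z = 0 → a = 0) →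
      Tendsto (fun n => cutoffDeriv (ε n) (q z) * a) atTop (𝓝 a) := fun z hz a ha => by
    rcases (hq0 z hz).eq_or_lt with h | h
    · simp [ha (hg₀0 z hz h.symm)]
    · have h1 := (tendsto_cutoffDeriv h).mul_const a
      rwa [one_mul] at h1
  obtain ⟨M, hM⟩ := hb.isCompact_closure.exists_bound_of_continuousOn hqc
  have hvol : volume Ω ≠ ⊤ := hb.measure_lt_top.ne
  -- the test function `conj g₀` is `z + conj (-f z)`, with derivative `∂(conj g₀) = 1`
  have henergy : ∀ n, IntegrableOn (fun z => cutoffDeriv (ε n) (q z) * ‖g₀ z‖ ^ 2) Ω ∧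
      ∫ z in Ω, cutoffDeriv (ε n) (q z) * ‖g₀ z‖ ^ 2 ≤ M * volume.real Ω := by
    intro n
    obtain ⟨h1, h2⟩ := integral_cutoffDeriv_mul hΩ hb hqc hqb hg₀c hqd hfd.neg 1 (hε n)
    have hform : ∀ z, (cutoffDeriv (ε n) (q z) : ℂ) * (g₀ z * (1 * z + conj ((-f) z)))
        = ((cutoffDeriv (ε n) (q z) * ‖g₀ z‖ ^ 2 : ℝ) : ℂ) := fun z => by
      have h3 : 1 * z + conj ((-f) z) = conj (g₀ z) := by simp [hg₀, sub_eq_add_neg]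
      rw [h3, Complex.mul_conj, Complex.normSq_eq_norm_sq, Complex.ofReal_mul]
    simp only [hform] at h1 h2
    rw [integral_complex_ofReal, integral_complex_ofReal, one_mul] at h2
    refine ⟨h1.re, ?_⟩
    rw [Complex.ofReal_inj.1 h2]
    refine (le_abs_self _).trans ?_
    rw [← Real.norm_eq_abs]
    refine norm_setIntegral_le_of_norm_le_const hvol.lt_top fun z hz => ?_
    have h4 := cutoff_le (hε n) (hq0 z hz)
    have h5 : 0 ≤ cutoff (ε n) (q z) := by
      unfold cutoff
      have : 0 < max (ε n) (q z) := lt_max_of_lt_left (hε n)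
      positivity
    rw [Real.norm_eq_abs, abs_of_nonneg h5]
    exact h4.trans ((le_abs_self _).trans (hM z (subset_closure hz)))
  have hmeas : AEStronglyMeasurable g₀ (volume.restrict Ω) :=
    hg₀c.aestronglyMeasurable hΩ.measurableSet
  have hg₀L : MemLp g₀ 2 (volume.restrict Ω) := by
    rw [memLp_two_iff_integrable_sq_norm hmeas]
    refine ⟨(hmeas.norm.pow 2), ?_⟩
    rw [hasFiniteIntegral_iff_ofReal (ae_of_all _ fun z => by positivity)]
    refine lt_of_le_of_lt ?_ (ENNReal.ofReal_lt_top (r := M * volume.real Ω))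
    calc ∫⁻ z in Ω, ENNReal.ofReal (‖g₀ z‖ ^ 2)
        = ∫⁻ z in Ω, liminf (fun n => ENNReal.ofReal (cutoffDeriv (ε n) (q z) * ‖g₀ z‖ ^ 2))
            atTop := by
          refine setLIntegral_congr_fun hΩ.measurableSet fun z hz => ?_
          refine ((ENNReal.continuous_ofReal.tendsto _).comp
            (hlim z hz (‖g₀ z‖ ^ 2) fun h => ?_)).liminf_eq.symm
          simp [h]
      _ ≤ liminf (fun n => ∫⁻ z in Ω, ENNReal.ofReal (cutoffDeriv (ε n) (q z) * ‖g₀ z‖ ^ 2))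
            atTop :=
          lintegral_liminf_le' fun n => (henergy n).1.aemeasurable.ennreal_ofReal
      _ ≤ ENNReal.ofReal (M * volume.real Ω) := by
          refine liminf_le_of_le (by isBoundedDefault) fun b hb => ?_
          obtain ⟨n, hn⟩ := hb.exists
          refine hn.trans ?_
          rw [← ofReal_integral_eq_lintegral_ofReal (henergy n).1 (ae_of_all _ fun z =>
            mul_nonneg (cutoffDeriv_mem_Icc (hε n) _).1 (by positivity))]
          exact ENNReal.ofReal_le_ofReal (henergy n).2
  have hconj := memLp_conj hΩ hb
  have hfL : MemLp f 2 (volume.restrict Ω) := by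
    have := hconj.sub hg₀L
    refine (memLp_congr_ae (ae_of_all _ fun z => ?_)).1 this
    simp [hg₀]
  refine ⟨⟨hfd, hfL⟩, fun g hg => ?_⟩
  have hgcL : MemLp (fun z => conj (g z)) 2 (volume.restrict Ω) := hg.2.star
  have hint : Integrable (fun z => g₀ z * conj (g z)) (volume.restrict Ω) :=
    hg₀L.integrable_mul hgcL
  have hzero : ∀ n, ∫ z in Ω, (cutoffDeriv (ε n) (q z) : ℂ) * (g₀ z * conj (g z)) = 0 := fun n => by
    have := (integral_cutoffDeriv_mul hΩ hb hqc hqb hg₀c hqd hg.1 0 (hε n)).2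
    simpa using this
  have htend : Tendsto (fun n => ∫ z in Ω, (cutoffDeriv (ε n) (q z) : ℂ) * (g₀ z * conj (g z)))
      atTop (𝓝 (∫ z in Ω, g₀ z * conj (g z))) := by
    refine tendsto_integral_of_dominated_convergence (fun z => ‖g₀ z * conj (g z)‖)
      (fun n => ?_) hint.norm (fun n => ae_of_all _ fun z => ?_) ?_
    · refine AEStronglyMeasurable.mul ?_ hint.aestronglyMeasurable
      exact (Complex.continuous_ofReal.comp_continuousOn
        ((continuous_cutoffDeriv (hε n)).comp_continuousOn hqΩ)).aestronglyMeasurable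
          hΩ.measurableSet
    · obtain ⟨h0, h1⟩ := cutoffDeriv_mem_Icc (hε n) (q z)
      rw [norm_mul, Complex.norm_real, Real.norm_eq_abs, abs_of_nonneg h0]
      exact mul_le_of_le_one_left (norm_nonneg _) h1
    · filter_upwards [ae_restrict_mem hΩ.measurableSet] with z hz
      rcases (hq0 z hz).eq_or_lt with h | h
      · simp [hg₀0 z hz h.symm]
      · have h1 := (Complex.continuous_ofReal.tendsto _).comp (tendsto_cutoffDeriv h)
        have h2 := h1.mul_const (g₀ z * conj (g z))
        rwa [Complex.ofReal_one, one_mul] at h2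
  simp only [hzero] at htend
  exact (tendsto_nhds_unique tendsto_const_nhds htend).symm

/-! ### Projection and best approximation -/

theorem bergmanSpace.eqOn_of_ae_eq {Ω : Set ℂ} (hΩ : IsOpen Ω) {f g : ℂ → ℂ}
    (hf : f ∈ bergmanSpace Ω) (hg : g ∈ bergmanSpace Ω) (h : f =ᵐ[volume.restrict Ω] g) :
    EqOn f g Ω :=
  Measure.eqOn_open_of_ae_eq h hΩ hf.1.continuousOn hg.1.continuousOn

theorem IsBergmanProjection.norm_sq_eq {Ω : Set ℂ} {h f g : ℂ → ℂ}
    (hh : MemLp h 2 (volume.restrict Ω)) (hf : IsBergmanProjection Ω h f)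
    (hg : g ∈ bergmanSpace Ω) :
    ‖(hh.sub hg.2).toLp‖ ^ 2 = ‖(hh.sub hf.1.2).toLp‖ ^ 2 + ‖(hf.1.2.sub hg.2).toLp‖ ^ 2 := by
  have hfg : f - g ∈ bergmanSpace Ω := (bergmanSpace Ω).sub_mem hf.1 hg
  have horth : inner ℂ (hf.1.2.sub hg.2).toLp (hh.sub hf.1.2).toLp = 0 := by
    rw [L2.inner_def]
    refine (integral_congr_ae ?_).trans (hf.2 (f - g) hfg)
    filter_upwards [(hf.1.2.sub hg.2).coeFn_toLp, (hh.sub hf.1.2).coeFn_toLp] with z h1 h2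
    rw [h1, h2]
    simp
  have hsum : (hh.sub hg.2).toLp = (hf.1.2.sub hg.2).toLp + (hh.sub hf.1.2).toLp := by
    rw [← MemLp.toLp_add]
    congr 1
    abel
  rw [hsum, @norm_add_sq ℂ, horth]
  simp
  ring

theorem IsBergmanProjection.isBestBergmanApproximation {Ω : Set ℂ} {h f : ℂ → ℂ}
    (hh : MemLp h 2 (volume.restrict Ω)) (hf : IsBergmanProjection Ω h f) :
    IsBestBergmanApproximation Ω h f := by
  refine ⟨hf.1, fun g hg => ?_⟩
  have h1 := hf.norm_sq_eq hh hg
  have h2 : ‖(hh.sub hf.1.2).toLp‖ ≤ ‖(hh.sub hg.2).toLp‖ :=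
    le_of_sq_le_sq (by nlinarith [sq_nonneg ‖(hf.1.2.sub hg.2).toLp‖]) (norm_nonneg _)
  rw [Lp.norm_toLp, Lp.norm_toLp] at h2
  exact (ENNReal.toReal_le_toReal (hh.sub hf.1.2).eLpNorm_ne_top (hh.sub hg.2).eLpNorm_ne_top).1 h2

theorem IsBergmanProjection.eqOn_of_isBest {Ω : Set ℂ} (hΩ : IsOpen Ω) {h f g : ℂ → ℂ}
    (hh : MemLp h 2 (volume.restrict Ω)) (hf : IsBergmanProjection Ω h f)
    (hg : IsBestBergmanApproximation Ω h g) : EqOn g f Ω := by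
  have h1 := hf.norm_sq_eq hh hg.1
  have h2 : ‖(hh.sub hg.1.2).toLp‖ ≤ ‖(hh.sub hf.1.2).toLp‖ := by
    rw [Lp.norm_toLp, Lp.norm_toLp]
    exact ENNReal.toReal_mono (hh.sub hf.1.2).eLpNorm_ne_top (hg.2 f hf.1)
  have h3 : ‖(hf.1.2.sub hg.1.2).toLp‖ = 0 := by
    have := norm_nonneg (hh.sub hg.1.2).toLp
    have : ‖(hf.1.2.sub hg.1.2).toLp‖ ^ 2 ≤ 0 := by nlinarith
    exact pow_eq_zero_iff two_ne_zero |>.1 (le_antisymm this (sq_nonneg _))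
  have h4 : f - g =ᵐ[volume.restrict Ω] 0 := by
    rw [Lp.norm_toLp, ENNReal.toReal_eq_zero_iff] at h3
    have h5 := h3.resolve_right (hf.1.2.sub hg.1.2).eLpNorm_ne_top
    exact (eLpNorm_eq_zero_iff (hf.1.2.sub hg.1.2).aestronglyMeasurable two_ne_zero).1 h5
  refine bergmanSpace.eqOn_of_ae_eq hΩ hg.1 hf.1 ?_
  filter_upwards [h4] with z hz
  exact (sub_eq_zero.1 hz).symm

theorem IsBergmanProjection.congr {Ω : Set ℂ} (hΩ : IsOpen Ω) {h f g : ℂ → ℂ}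
    (hf : IsBergmanProjection Ω h f) (hgf : EqOn g f Ω) : IsBergmanProjection Ω h g := by
  refine ⟨⟨hf.1.1.congr hgf, (memLp_congr_ae ?_).1 hf.1.2⟩, fun k hk => ?_⟩
  · filter_upwards [ae_restrict_mem hΩ.measurableSet] with z hz using (hgf hz).symm
  · rw [← hf.2 k hk]
    exact setIntegral_congr_fun hΩ.measurableSet fun z hz => by simp only [hgf hz]

theorem IsBergmanProjection.iff_eqOn {Ω : Set ℂ} (hΩ : IsOpen Ω) {h f₀ f : ℂ → ℂ}
    (hh : MemLp h 2 (volume.restrict Ω)) (hf₀ : IsBergmanProjection Ω h f₀) :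
    (IsBergmanProjection Ω h f ↔ EqOn f f₀ Ω) ∧
      (IsBestBergmanApproximation Ω h f ↔ EqOn f f₀ Ω) :=
  ⟨⟨fun hf => hf₀.eqOn_of_isBest hΩ hh (hf.isBestBergmanApproximation hh),
      fun hf => hf₀.congr hΩ hf⟩,
    ⟨fun hf => hf₀.eqOn_of_isBest hΩ hh hf,
      fun hf => (hf₀.congr hΩ hf).isBestBergmanApproximation hh⟩⟩

end

theorem theorem2p1 (Ω : Set ℂ) (hopen : IsOpen Ω) (hconn : IsConnected Ω)
    (hbdd : Bornology.IsBounded Ω) (hfin : FinitelyConnected Ω)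
    (hnondeg : ∀ z ∈ Ωᶜ, (connectedComponentIn Ωᶜ z).Nontrivial) :
    (∀ f : ℂ → ℂ, IsBergmanProjection Ω (fun z => conj z) f ↔
      ∃ u : ℂ → ℝ, IsTwiceRePrimitive Ω f u ∧ ContinuousOn u (closure Ω) ∧
        ∀ ζ ∈ frontier Ω, u ζ = ‖ζ‖ ^ 2) ∧
    ∃ u : ℂ → ℝ, IsDirichletSolution Ω (fun z => ‖z‖ ^ 2) u ∧
      (∀ v : ℂ → ℝ, IsDirichletSolution Ω (fun z => ‖z‖ ^ 2) v → Set.EqOn v u (closure Ω)) ∧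
      ∀ f : ℂ → ℂ, IsBestBergmanApproximation Ω (fun z => conj z) f ↔
        IsTwiceRePrimitive Ω f u := by
  obtain ⟨u, hu⟩ := exists_isDirichletSolution hopen hconn hbdd hnondeg
    (φ := fun z => ‖z‖ ^ 2) (by fun_prop) (locallySubmean_norm_sq Ω)
  have hproj := isBergmanProjection_wirtingerDeriv hopen hbdd hu
  have hiff := fun f => hproj.iff_eqOn (f := f) hopen (memLp_conj hopen hbdd)
  refine ⟨fun f => ?_, u, hu, fun v hv => hu.eqOn hopen hbdd hv, fun f => ?_⟩
  · rw [(hiff f).1]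
    constructor
    · exact fun hf => ⟨u, (isTwiceRePrimitive_iff hopen).2 ⟨hu.harmonic, hf⟩, hu.continuousOn,
        hu.boundary⟩
    · rintro ⟨v, hv, hvc, hvb⟩
      obtain ⟨hvh, hvf⟩ := (isTwiceRePrimitive_iff hopen).1 hv
      have hvu := hu.eqOn hopen hbdd ⟨hvc, hvh, hvb⟩
      exact hvf.trans (wirtingerDeriv_congr hopen (hvu.mono subset_closure))
  · rw [(hiff f).2, isTwiceRePrimitive_iff hopen]
    exact ⟨fun hf => ⟨hu.harmonic, hf⟩, fun hf => hf.2⟩
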